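/- An instance of fair division with social impact consists of a finite set $N$ of agents, a finite set $M$ of items and, for each agent $i\in N$, two additive functions $v_i,s_i\colon 2^M\to\mathbb N_0$, the valuation and the social impact of $i$, given by their values $v_i(\{g\}),s_i(\{g\})$ on single items. An allocation is a family $A=(A_i)_{i\in N}$ of pairwise disjoint (possibly empty) sets with $\bigcup_{i\in N}A_i=M$. It is social impact maximizing (SIM) if $\sum_{i}s_i(A_i)\ge\sum_i s_i(A'_i)$ for every allocation $A'$. Given positive rational weights $(w_i)_{i\in N}$, used only for wEF1 and swEF1, the allocation $A$ is * EF if $v_i(A_i)\ge v_i(A_j)$ for all $i,j\in N$; * EF1 if for all $i,j\in N$ there is $g\in M$ with $v_i(A_i)\ge v_i(A_j\setminus\{g\})$; * sEF1 if for every $j\in N$ there is $g\in M$ such that $v_i(A_i)\ge v_i(A_j\setminus\{g\})$ for all $i\in N$; * wEF1 if for all $i,j\in N$ there is $g\in M$ with $v_i(A_i)/w_i\ge v_i(A_j\setminus\{g\})/w_j$; * swEF1 if for every $j\in N$ there is $g\in M$ such that $v_i(A_i)/w_i\ge v_i(A_j\setminus\{g\})/w_j$ for all $i\in N$; * EFL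 if for all $i,j\in N$, either $A_j$ contains at most one item $g$ with $v_i(\{g\})>0$, or there is $g\in A_j$ with $v_i(A_i)\ge v_i(A_j\setminus\{g\})$ and $v_i(A_i)\ge v_i(\{g\})$; * tEF1 if for all $i,j\in N$ with $v_i(A_i)<v_i(A_j)$ there is $g\in A_j$ with $v_i(A_i\cup\{g\})\ge v_i(A_j\setminus\{g\})$. **Theorem.** For every fixed number $n$ of agents and every $\mathcal F\in\{\text{tEF1},\text{EF1},\text{sEF1},\text{wEF1},\text{swEF1},\text{EFL},\text{EF}\}$ there is a pseudo-polynomial-time algorithm which, given an instance with $n$ agents (together with positive rational weights if $\mathcal F\in\{\text{wEF1},\text{swEF1}\}$), decides whether there is an allocation that is both SIM and $\mathcal F$-fair. More precisely, there is a program for a random access machine with logarithmic cost (over natural numbers, with addition, truncated subtraction, multiplication, integer division and indirect addressing) which decides this question, and a polynomial $p$ such that on every instance the cost of its computation is at most $p(L+\nu)$, where $L$ is the length of the input with all numbers (values, social impacts, weights) written in binary, and $\nu=\max_{i\in N,\,g\in M}v_i(\{g\})$ (with $\nu=0$ if $N$ or $M$ is empty) is the largest value of an item. The program and $p$ depend only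 on $n$ and $\mathcal F$. -/

import Mathlib

/-! ## A random access machine with logarithmic cost -/

namespace RAM

/-- Arithmetic operations of the machine, all on natural numbers: subtraction is truncated,
division is rounded down (and division by zero gives zero). -/
inductive Op
  | add
  | sub
  | mul
  | div

/-- The value of an arithmetic operation. -/
def Op.eval : Op → ℕ → ℕ → ℕ
  | .add, a, b => a + b
  | .sub, a, b => a - b
  | .mul, a, b => a * b
  | .div, a, b => a / b

/-- Programs. A program is a finite object: it mentions finitely many registers and constants. -/
inductive Prog
  /-- do nothing -/
  | skip
  /-- `reg i := c` -/
  | const (i c : ℕ)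
  /-- `reg i := reg j ∘ reg k` -/
  | op (o : Op) (i j k : ℕ)
  /-- `reg i := mem (reg j)` -/
  | load (i j : ℕ)
  /-- `mem (reg i) := reg j` -/
  | store (i j : ℕ)
  /-- first `P`, then `Q` -/
  | seq (P Q : Prog)
  /-- `P` if `reg i ≠ 0`, and `Q` otherwise -/
  | ite (i : ℕ) (P Q : Prog)
  /-- while `reg i ≠ 0` do `P` -/
  | loop (i : ℕ) (P : Prog)

/-- A state of the machine: registers and an indirectly addressed memory. -/
structure State where
  reg : ℕ → ℕ
  mem : ℕ → ℕ

/-- The state in which a computation with input `l` starts: the input stands in the memory cells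
`0, …, l.length - 1`, and all other cells and all registers are `0`. -/
def State.init (l : List ℕ) : State where
  reg := fun _ => 0
  mem := fun a => l.getD a 0

/-- Overwrite register `i`. -/
def State.setReg (σ : State) (i x : ℕ) : State := { σ with reg := Function.update σ.reg i x }

/-- Overwrite memory cell `a`. -/
def State.setMem (σ : State) (a x : ℕ) : State := { σ with mem := Function.update σ.mem a x }

/-- `Exec P σ t τ`: started in state `σ`, the program `P` halts in state `τ` after a computation
of total cost `t`. Costs are logarithmic: every instruction is charged for the number of binary
digits (`Nat.size`) of all the numbers and memory addresses it handles, and an arithmetic operation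
is charged for the product of the digit counts of its operands (schoolbook arithmetic). -/
inductive Exec : Prog → State → ℕ → State → Prop
  | skip (σ : State) : Exec .skip σ 1 σ
  | const (σ : State) (i c : ℕ) : Exec (.const i c) σ (1 + Nat.size c) (σ.setReg i c)
  | op (σ : State) (o : Op) (i j k : ℕ) :
      Exec (.op o i j k) σ ((1 + Nat.size (σ.reg j)) * (1 + Nat.size (σ.reg k)))
        (σ.setReg i (o.eval (σ.reg j) (σ.reg k)))
  | load (σ : State) (i j : ℕ) :
      Exec (.load i j) σ (1 + Nat.size (σ.reg j) + Nat.size (σ.mem (σ.reg j)))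
        (σ.setReg i (σ.mem (σ.reg j)))
  | store (σ : State) (i j : ℕ) :
      Exec (.store i j) σ (1 + Nat.size (σ.reg i) + Nat.size (σ.reg j))
        (σ.setMem (σ.reg i) (σ.reg j))
  | seq {P Q : Prog} {σ ρ τ : State} {t u : ℕ} :
      Exec P σ t ρ → Exec Q ρ u τ → Exec (.seq P Q) σ (t + u) τ
  | iteTrue {i : ℕ} {P Q : Prog} {σ τ : State} {t : ℕ} :
      σ.reg i ≠ 0 → Exec P σ t τ → Exec (.ite i P Q) σ (1 + Nat.size (σ.reg i) + t) τ
  | iteFalse {i : ℕ} {P Q : Prog} {σ τ : State} {t : ℕ} :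
      σ.reg i = 0 → Exec Q σ t τ → Exec (.ite i P Q) σ (1 + Nat.size (σ.reg i) + t) τ
  | loopTrue {i : ℕ} {P : Prog} {σ ρ τ : State} {t u : ℕ} :
      σ.reg i ≠ 0 → Exec P σ t ρ → Exec (.loop i P) ρ u τ →
        Exec (.loop i P) σ (1 + Nat.size (σ.reg i) + t + u) τ
  | loopFalse {i : ℕ} {P : Prog} {σ : State} :
      σ.reg i = 0 → Exec (.loop i P) σ (1 + Nat.size (σ.reg i)) σ

/-- The size of an input in binary: the total number of binary digits, plus one for each number. -/
def inputSize (l : List ℕ) : ℕ := (l.map fun x => 1 + Nat.size x).sum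

/-- On input `l` the program `P` halts at cost at most `T`, with answer `1` in register `0` if `Q`
holds and with answer `0` otherwise. -/
def DecidesWithin (P : Prog) (l : List ℕ) (Q : Prop) (T : ℕ) : Prop :=
  ∃ (t : ℕ) (τ : State), Exec P (State.init l) t τ ∧ t ≤ T ∧
    ((Q ∧ τ.reg 0 = 1) ∨ (¬ Q ∧ τ.reg 0 = 0))

end RAM

/-! ## Fair division with social impact -/

namespace FairDivision

/-- An instance with `n` agents: `m` items, and for each agent `i` and item `g` the value `v i g`
and the social impact `s i g`. -/
structure Instance (n : ℕ) where
  m : ℕ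
  v : Fin n → Fin m → ℕ
  s : Fin n → Fin m → ℕ

namespace Instance

variable {n : ℕ}

/-- The (additive, normalized) valuation function of agent `i`. -/
def val (I : Instance n) (i : Fin n) (S : Finset (Fin I.m)) : ℕ := ∑ g ∈ S, I.v i g

/-- The (additive, normalized) social impact function of agent `i`. -/
def impact (I : Instance n) (i : Fin n) (S : Finset (Fin I.m)) : ℕ := ∑ g ∈ S, I.s i g

/-- Complete allocations: the bundles are pairwise disjoint and cover all items. -/
def IsAllocation (I : Instance n) (A : Fin n → Finset (Fin I.m)) : Prop :=
  (∀ i j, i ≠ j → Disjoint (A i) (A j)) ∧ ∀ g, ∃ i, g ∈ A i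

/-- The overall social impact of an allocation. -/
def SI (I : Instance n) (A : Fin n → Finset (Fin I.m)) : ℕ := ∑ i, I.impact i (A i)

/-- Social impact maximizing allocations. -/
def IsSIM (I : Instance n) (A : Fin n → Finset (Fin I.m)) : Prop :=
  I.IsAllocation A ∧ ∀ A', I.IsAllocation A' → I.SI A' ≤ I.SI A

/-- The largest value of a single item for an agent (`0` if there is no item or no agent). -/
def maxValue (I : Instance n) : ℕ :=
  Finset.univ.sup fun i : Fin n => Finset.univ.sup fun g : Fin I.m => I.v i g

/-- Envy-freeness. -/
def EF (I : Instance n) (A : Fin n → Finset (Fin I.m)) : Prop :=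
  ∀ i j, I.val i (A j) ≤ I.val i (A i)

/-- Envy-freeness up to one item. -/
def EF1 (I : Instance n) (A : Fin n → Finset (Fin I.m)) : Prop :=
  ∀ i j, ∃ g, I.val i (A j \ {g}) ≤ I.val i (A i)

/-- Strong envy-freeness up to one item. -/
def SEF1 (I : Instance n) (A : Fin n → Finset (Fin I.m)) : Prop :=
  ∀ j, ∃ g, ∀ i, I.val i (A j \ {g}) ≤ I.val i (A i)

/-- Weighted envy-freeness up to one item, for the weights `w`. -/
def WEF1 (I : Instance n) (w : Fin n → ℚ) (A : Fin n → Finset (Fin I.m)) : Prop :=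
  ∀ i j, ∃ g, (I.val i (A j \ {g}) : ℚ) / w j ≤ (I.val i (A i) : ℚ) / w i

/-- Strong weighted envy-freeness up to one item, for the weights `w`. -/
def SWEF1 (I : Instance n) (w : Fin n → ℚ) (A : Fin n → Finset (Fin I.m)) : Prop :=
  ∀ j, ∃ g, ∀ i, (I.val i (A j \ {g}) : ℚ) / w j ≤ (I.val i (A i) : ℚ) / w i

/-- Envy-freeness up to one less preferred item. -/
def EFL (I : Instance n) (A : Fin n → Finset (Fin I.m)) : Prop :=
  ∀ i j, ((A j).filter fun g => 0 < I.v i g).card ≤ 1 ∨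
    ∃ g ∈ A j, I.val i (A j \ {g}) ≤ I.val i (A i) ∧ I.val i {g} ≤ I.val i (A i)

/-- Envy-freeness up to one transfer. -/
def TEF1 (I : Instance n) (A : Fin n → Finset (Fin I.m)) : Prop :=
  ∀ i j, I.val i (A i) < I.val i (A j) →
    ∃ g ∈ A j, I.val i (A j \ {g}) ≤ I.val i (A i ∪ {g})

end Instance

/-- The seven fairness notions. -/
inductive Notion
  | tEF1
  | EF1
  | sEF1
  | wEF1
  | swEF1
  | EFL
  | EF

/-- The notions that depend on weights of the agents. -/
def Notion.weighted : Notion → Bool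
  | .wEF1 | .swEF1 => true
  | _ => false

/-- `F`-fairness of an allocation; the weights `w` matter only for the two weighted notions. -/
def Instance.IsFair {n : ℕ} (I : Instance n) (w : Fin n → ℚ) (F : Notion)
    (A : Fin n → Finset (Fin I.m)) : Prop :=
  match F with
  | .tEF1 => I.TEF1 A
  | .EF1 => I.EF1 A
  | .sEF1 => I.SEF1 A
  | .wEF1 => I.WEF1 w A
  | .swEF1 => I.SWEF1 w A
  | .EFL => I.EFL A
  | .EF => I.EF A

/-- The input that represents an instance: the number of items; then item by item, and for each
item agent by agent, the value and the social impact; then, for the weighted notions only, agent by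
agent the numerator and the denominator of the weight. -/
def encode {n : ℕ} (F : Notion) (I : Instance n) (w : Fin n → ℚ) : List ℕ :=
  I.m ::
    (((List.finRange I.m).flatMap fun g => (List.finRange n).flatMap fun i => [I.v i g, I.s i g]) ++
      (if F.weighted then (List.finRange n).flatMap fun i => [(w i).num.toNat, (w i).den] else []))

end FairDivision

/-! Social impact is a sum over items, so maximality is local: an allocation is SIM exactly when
every item goes to an agent with the largest impact for it (`isSIM_bundles_iff`). Impacts are
therefore compared but never added, and their magnitude enters only through their digits.

All seven notions take one form (`isFair_iff`): for each pair `i`, `j` there is a set of at most one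
item in the bundle of `j` such that `Notion.Local` holds. This condition involves the value for `i`
of her own bundle, of the bundle of `j` and of the witness set, and the size of that set. In the
strong notions the set must not depend on `i`. Hence an allocation with chosen witnesses matters
only through `3 * n ^ 2` numbers, each a sum of contributions of single items. A dynamic program
over the items, whose moves choose an owner and the agents for which the item is a witness, ranges
over all these vectors (`exists_isSIM_isFair_iff`).

A vector is stored as one number in base `B = digitBound`, where `B` exceeds every partial sum, so
that adding codes never produces a carry. The table has one row for each number of processed items
and `B ^ (3 * n ^ 2)` cells per row, which is polynomial in the input length and the largest value
because `n` is fixed. Every move leads to a larger address, so one pass over the table finds all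
reachable cells (`Search.Spec.iterate_spec`, `exists_accepted_iff`).

On the machine, an expression is evaluated at a cost quadratic in the number of digits
(`Expr.exists_exec_compile`), and `Implements` carries such bounds through straight-line code. Loops
need a bound on digits that holds in all rounds (`Implements.exists_runs_loop`). It exists because
the first loop forms partial sums below `B` and the second only writes ones and decreases its
counter. The case `n = 0`, where there are no moves, is separate. -/

namespace RAM

/-! ### Compilation of arithmetic expressions and its cost -/

/-- The part of a machine state that expressions and blocks can see: an answer register, two
working registers and the memory. All other registers are scratch space. -/
structure Env where
  ans : ℕ
  acc : ℕ
  cnt : ℕ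
  mem : ℕ → ℕ

/-- The visible part of a state. -/
def State.env (σ : State) : Env := ⟨σ.reg 0, σ.reg 1, σ.reg 2, σ.mem⟩

/-- The working registers and all memory cells hold numbers of at most `z` binary digits. -/
structure Env.Small (z : ℕ) (E : Env) : Prop where
  acc : E.acc.size ≤ z
  cnt : E.cnt.size ≤ z
  mem : ∀ a, (E.mem a).size ≤ z

theorem Env.Small.mono {z z' : ℕ} {E : Env} (h : E.Small z) (hz : z ≤ z') : E.Small z' :=
  ⟨h.acc.trans hz, h.cnt.trans hz, fun a => (h.mem a).trans hz⟩

theorem size_le_self (a : ℕ) : a.size ≤ a := Nat.size_le.2 Nat.lt_two_pow_self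

theorem Op.size_eval_le (o : Op) (a b : ℕ) : (o.eval a b).size ≤ a.size + b.size + 1 := by
  have ha := Nat.lt_size_self a
  have hb := Nat.lt_size_self b
  cases o with
  | add =>
    have h1 : 2 ^ a.size ≤ 2 ^ (a.size + b.size) := Nat.pow_le_pow_right (by norm_num) (by omega)
    have h2 : 2 ^ b.size ≤ 2 ^ (a.size + b.size) := Nat.pow_le_pow_right (by norm_num) (by omega)
    refine Nat.size_le.2 ?_
    rw [pow_succ]
    simp only [Op.eval]
    omega
  | sub => exact (Nat.size_le_size (Nat.sub_le a b)).trans (by omega)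
  | mul =>
    refine (Nat.size_le (n := a.size + b.size).2 ?_).trans (by omega)
    rw [pow_add]
    exact Nat.mul_lt_mul'' ha hb
  | div => exact (Nat.size_le_size (Nat.div_le_self a b)).trans (by omega)

/-- Arithmetic expressions over the visible part of a state. -/
inductive Expr
  | const (c : ℕ)
  | acc
  | cnt
  | mem (e : Expr)
  | op (o : Op) (a b : Expr)

namespace Expr

/-- The value of an expression. -/
def eval (E : Env) : Expr → ℕ
  | const c => c
  | acc => E.acc
  | cnt => E.cnt
  | mem e => E.mem (e.eval E)
  | op o a b => o.eval (a.eval E) (b.eval E)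

/-- Code that evaluates an expression into register `k`, using the registers from `k` on. -/
def compile : Expr → ℕ → Prog
  | const c, k => .const k c
  | acc, k => .seq (.const k 0) (.op .add k 1 k)
  | cnt, k => .seq (.const k 0) (.op .add k 2 k)
  | mem e, k => .seq (e.compile k) (.load k k)
  | op o a b, k => .seq (a.compile k) (.seq (b.compile (k + 1)) (.op o k k (k + 1)))

/-- An operation at most adds the digit counts of its operands, plus one; the expression is fixed,
so the growth factor does not depend on the state. -/
theorem exists_size_eval_le (e : Expr) :
    ∃ w, ∀ z E, E.Small z → (e.eval E).size ≤ w * (z + 1) := by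
  induction e with
  | const c => exact ⟨c.size, fun z E _ => Nat.le_mul_of_pos_right _ (by omega)⟩
  | acc => exact ⟨1, fun z E h => h.acc.trans (by omega)⟩
  | cnt => exact ⟨1, fun z E h => h.cnt.trans (by omega)⟩
  | mem e _ => exact ⟨1, fun z E h => (h.mem _).trans (by omega)⟩
  | op o a b iha ihb =>
    obtain ⟨u, hu⟩ := iha
    obtain ⟨w, hw⟩ := ihb
    refine ⟨u + w + 1, fun z E h => (o.size_eval_le _ _).trans ?_⟩
    have h1 := hu z E h
    have h2 := hw z E h
    calc _ ≤ u * (z + 1) + w * (z + 1) + 1 := by omega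
      _ ≤ _ := by nlinarith

end Expr

theorem State.env_eq_of_agree {σ τ : State} (hm : τ.mem = σ.mem)
    (hr : ∀ i < 3, τ.reg i = σ.reg i) : τ.env = σ.env := by
  simp only [State.env, hm, hr 0 (by omega), hr 1 (by omega), hr 2 (by omega)]

theorem State.setReg_reg_of_ne (σ : State) {i j : ℕ} (x : ℕ) (h : j ≠ i) :
    (σ.setReg i x).reg j = σ.reg j := Function.update_of_ne h _ _

@[simp] theorem State.setReg_reg_self (σ : State) (i x : ℕ) : (σ.setReg i x).reg i = x :=
  Function.update_self _ _ _

theorem exec_copy (σ : State) (i k : ℕ) (hik : i ≠ k) :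
    Exec (.seq (.const k 0) (.op .add k i k)) σ (2 + (σ.reg i).size)
      ((σ.setReg k 0).setReg k (σ.reg i)) := by
  have h := Exec.seq (Exec.const σ k 0) (Exec.op (σ.setReg k 0) .add k i k)
  rw [State.setReg_reg_of_ne _ _ hik, State.setReg_reg_self] at h
  simp only [Nat.size_zero, Op.eval, add_zero, mul_one] at h
  convert h using 1
  omega

/-- Registers are used like a stack: code for target `k` leaves those below `k` alone, so the second
operand can be computed in `k + 1` while the first waits in `k`. The condition `3 ≤ k` protects the
three visible registers. -/
theorem Expr.exists_exec_compile (e : Expr) :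
    ∃ K, ∀ z k σ, 3 ≤ k → σ.env.Small z → ∃ t τ, Exec (e.compile k) σ t τ ∧
      t ≤ K * (z + 1) ^ 2 ∧ τ.mem = σ.mem ∧ (∀ i < k, τ.reg i = σ.reg i) ∧
      τ.reg k = e.eval σ.env := by
  induction e with
  | const c =>
    refine ⟨1 + c.size, fun z k σ _ _ => ⟨_, _, Exec.const σ k c, ?_, rfl, ?_, ?_⟩⟩
    · exact Nat.le_mul_of_pos_right _ (by positivity)
    · exact fun i hi => State.setReg_reg_of_ne _ _ hi.ne
    · exact State.setReg_reg_self _ _ _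
  | acc =>
    refine ⟨2, fun z k σ hk hσ => ⟨_, _, exec_copy σ 1 k (by omega), ?_, rfl, ?_, ?_⟩⟩
    · have : (σ.reg 1).size ≤ z := hσ.acc
      nlinarith
    · intro i hi
      rw [State.setReg_reg_of_ne _ _ hi.ne, State.setReg_reg_of_ne _ _ hi.ne]
    · exact State.setReg_reg_self _ _ _
  | cnt =>
    refine ⟨2, fun z k σ hk hσ => ⟨_, _, exec_copy σ 2 k (by omega), ?_, rfl, ?_, ?_⟩⟩
    · have : (σ.reg 2).size ≤ z := hσ.cnt
      nlinarith
    · intro i hi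
      rw [State.setReg_reg_of_ne _ _ hi.ne, State.setReg_reg_of_ne _ _ hi.ne]
    · exact State.setReg_reg_self _ _ _
  | mem e ih =>
    obtain ⟨K, hK⟩ := ih
    obtain ⟨w, hw⟩ := e.exists_size_eval_le
    refine ⟨K + w + 1, fun z k σ hk hσ => ?_⟩
    obtain ⟨t, τ, hx, ht, hm, hr, hv⟩ := hK z k σ hk hσ
    refine ⟨_, _, Exec.seq hx (Exec.load τ k k), ?_, hm, ?_, ?_⟩
    · rw [hv, hm]
      have h1 := hw z _ hσ
      have h2 : (σ.mem (e.eval σ.env)).size ≤ z := hσ.mem _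
      have h3 : w * (z + 1) ≤ w * (z + 1) ^ 2 := Nat.mul_le_mul_left _ (by nlinarith)
      nlinarith
    · intro i hi
      rw [State.setReg_reg_of_ne _ _ hi.ne, hr i hi]
    · rw [State.setReg_reg_self, hv, hm]
      rfl
  | op o a b iha ihb =>
    obtain ⟨K, hK⟩ := iha
    obtain ⟨M, hM⟩ := ihb
    obtain ⟨u, hu⟩ := a.exists_size_eval_le
    obtain ⟨w, hw⟩ := b.exists_size_eval_le
    refine ⟨K + M + (1 + u) * (1 + w), fun z k σ hk hσ => ?_⟩
    obtain ⟨t, τ, hx, ht, hm, hr, hv⟩ := hK z k σ hk hσ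
    have henv : τ.env = σ.env := State.env_eq_of_agree hm fun i hi => hr i (by omega)
    obtain ⟨t', τ', hx', ht', hm', hr', hv'⟩ :=
      hM z (k + 1) τ (by omega) (henv ▸ hσ)
    refine ⟨_, _, Exec.seq hx (Exec.seq hx' (Exec.op τ' o k k (k + 1))), ?_, hm'.trans hm, ?_, ?_⟩
    · rw [hv', hr' k (by omega), hv, henv]
      have h1 : 1 + (a.eval σ.env).size ≤ (1 + u) * (z + 1) := by have := hu z _ hσ; nlinarith
      have h2 : 1 + (b.eval σ.env).size ≤ (1 + w) * (z + 1) := by have := hw z _ hσ; nlinarith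
      have h3 := Nat.mul_le_mul h1 h2
      nlinarith
    · intro i hi
      rw [State.setReg_reg_of_ne _ _ hi.ne, hr' i (by omega), hr i hi]
    · rw [State.setReg_reg_self, hv', hr' k (by omega), hv, henv]
      rfl

/-! ### Straight-line code and loops as transformations of the visible state -/

/-- From every state with visible part `E`, the program `P` halts at cost at most `T` in a state
with visible part `E'`. -/
def Runs (P : Prog) (E : Env) (T : ℕ) (E' : Env) : Prop :=
  ∀ σ : State, σ.env = E → ∃ t τ, Exec P σ t τ ∧ t ≤ T ∧ τ.env = E'

theorem Runs.seq {P Q : Prog} {E E' E'' : Env} {T U : ℕ} (h : Runs P E T E')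
    (h' : Runs Q E' U E'') : Runs (.seq P Q) E (T + U) E'' := by
  intro σ hσ
  obtain ⟨t, τ, hx, ht, hτ⟩ := h σ hσ
  obtain ⟨u, ρ, hy, hu, hρ⟩ := h' τ hτ
  exact ⟨_, _, hx.seq hy, by omega, hρ⟩

theorem Runs.mono {P : Prog} {E E' : Env} {T U : ℕ} (h : Runs P E T E') (hTU : T ≤ U) :
    Runs P E U E' := by
  intro σ hσ
  obtain ⟨t, τ, hx, ht, hτ⟩ := h σ hσ
  exact ⟨_, _, hx, ht.trans hTU, hτ⟩

/-- The program `P` transforms visible parts of states by `f`, the number of digits grows at most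
linearly, and the cost is at most quadratic in the number of digits. -/
def Implements (P : Prog) (f : Env → Env) : Prop :=
  ∃ K, ∀ z E, E.Small z → (f E).Small (K * (z + 1)) ∧ Runs P E (K * (z + 1) ^ 2) (f E)

theorem implements_skip : Implements .skip id := by
  refine ⟨1, fun z E h => ⟨h.mono (by omega), fun σ hσ => ⟨_, _, Exec.skip σ, ?_, hσ⟩⟩⟩
  exact Nat.le_mul_of_pos_right _ (by positivity)

theorem Implements.seq {P Q : Prog} {f g : Env → Env} (hP : Implements P f)
    (hQ : Implements Q g) : Implements (.seq P Q) (fun E => g (f E)) := by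
  obtain ⟨K, hK⟩ := hP
  obtain ⟨M, hM⟩ := hQ
  -- The second program starts with numbers of up to `K * (z + 1)` digits; `(K + 1) ^ 2` comes from
  -- inserting this into its quadratic cost.
  refine ⟨K + M * (K + 1) ^ 2, fun z E h => ?_⟩
  obtain ⟨h1, h2⟩ := hK z E h
  obtain ⟨h3, h4⟩ := hM _ _ h1
  have h5 : K * (z + 1) + 1 ≤ (K + 1) * (z + 1) := by nlinarith
  refine ⟨h3.mono ?_, (h2.seq h4).mono ?_⟩
  · calc M * (K * (z + 1) + 1) ≤ M * ((K + 1) * (z + 1)) := Nat.mul_le_mul_left _ h5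
      _ ≤ M * ((K + 1) ^ 2 * (z + 1)) := by gcongr; nlinarith
      _ ≤ _ := by nlinarith
  · calc _ ≤ K * (z + 1) ^ 2 + M * ((K + 1) * (z + 1)) ^ 2 := by gcongr
      _ = _ := by ring

/-- `acc := e` -/
def Prog.setAcc (e : Expr) : Prog := .seq (e.compile 3) (.seq (.const 1 0) (.op .add 1 3 1))

/-- `cnt := e` -/
def Prog.setCnt (e : Expr) : Prog := .seq (e.compile 3) (.seq (.const 2 0) (.op .add 2 3 2))

/-- `mem a := e` -/
def Prog.write (a e : Expr) : Prog := .seq (a.compile 3) (.seq (e.compile 4) (.store 3 4))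

/-- `P` if `e` is not zero, and `Q` otherwise. -/
def Prog.cond (e : Expr) (P Q : Prog) : Prog := .seq (e.compile 3) (.ite 3 P Q)

theorem implements_setAcc (e : Expr) :
    Implements (.setAcc e) (fun E => { E with acc := e.eval E }) := by
  obtain ⟨K, hK⟩ := e.exists_exec_compile
  obtain ⟨w, hw⟩ := e.exists_size_eval_le
  refine ⟨K + w + 2, fun z E h => ⟨⟨?_, ?_, fun a => ?_⟩, fun σ hσ => ?_⟩⟩
  · have := hw z E h
    dsimp only
    nlinarith
  · exact h.cnt.trans (by nlinarith)
  · exact (h.mem a).trans (by nlinarith)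
  subst hσ
  obtain ⟨t, τ, hx, ht, hm, hr, hv⟩ := hK z 3 σ le_rfl h
  refine ⟨_, _, hx.seq (exec_copy τ 3 1 (by omega)), ?_, ?_⟩
  · rw [hv]
    have := hw z _ h
    nlinarith
  · simp [State.env, State.setReg, hm, hv, hr 0, hr 2]

theorem implements_setCnt (e : Expr) :
    Implements (.setCnt e) (fun E => { E with cnt := e.eval E }) := by
  obtain ⟨K, hK⟩ := e.exists_exec_compile
  obtain ⟨w, hw⟩ := e.exists_size_eval_le
  refine ⟨K + w + 2, fun z E h => ⟨⟨?_, ?_, fun a => ?_⟩, fun σ hσ => ?_⟩⟩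
  · exact h.acc.trans (by nlinarith)
  · have := hw z E h
    dsimp only
    nlinarith
  · exact (h.mem a).trans (by nlinarith)
  subst hσ
  obtain ⟨t, τ, hx, ht, hm, hr, hv⟩ := hK z 3 σ le_rfl h
  refine ⟨_, _, hx.seq (exec_copy τ 3 2 (by omega)), ?_, ?_⟩
  · rw [hv]
    have := hw z _ h
    nlinarith
  · simp [State.env, State.setReg, hm, hv, hr 0, hr 1]

theorem implements_setAns (c : ℕ) :
    Implements (.const 0 c) (fun E => { E with ans := c }) := by
  refine ⟨1 + c.size, fun z E h => ⟨⟨?_, ?_, fun a => ?_⟩, fun σ hσ => ?_⟩⟩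
  · exact h.acc.trans (by nlinarith)
  · exact h.cnt.trans (by nlinarith)
  · exact (h.mem a).trans (by nlinarith)
  subst hσ
  refine ⟨_, _, Exec.const σ 0 c, Nat.le_mul_of_pos_right _ (by positivity), ?_⟩
  simp [State.env, State.setReg]

theorem implements_write (a e : Expr) :
    Implements (.write a e)
      (fun E => { E with mem := Function.update E.mem (a.eval E) (e.eval E) }) := by
  obtain ⟨K, hK⟩ := a.exists_exec_compile
  obtain ⟨M, hM⟩ := e.exists_exec_compile
  obtain ⟨u, hu⟩ := a.exists_size_eval_le
  obtain ⟨w, hw⟩ := e.exists_size_eval_le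
  refine ⟨K + M + u + w + 1, fun z E h => ⟨⟨?_, ?_, fun b => ?_⟩, fun σ hσ => ?_⟩⟩
  · exact h.acc.trans (by nlinarith)
  · exact h.cnt.trans (by nlinarith)
  · have h1 := hw z E h
    have h2 := h.mem b
    dsimp only
    rw [Function.update_apply]
    split <;> nlinarith
  subst hσ
  obtain ⟨t, τ, hx, ht, hm, hr, hv⟩ := hK z 3 σ le_rfl h
  have henv : τ.env = σ.env := State.env_eq_of_agree hm hr
  obtain ⟨t', τ', hx', ht', hm', hr', hv'⟩ := hM z 4 τ (by omega) (henv ▸ h)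
  refine ⟨_, _, hx.seq (hx'.seq (Exec.store τ' 3 4)), ?_, ?_⟩
  · rw [hv', hr' 3 (by omega), hv, henv]
    have h1 := hu z _ h
    have h2 := hw z _ h
    have h3 : u * (z + 1) ≤ u * (z + 1) ^ 2 := Nat.mul_le_mul_left _ (by nlinarith)
    have h4 : w * (z + 1) ≤ w * (z + 1) ^ 2 := Nat.mul_le_mul_left _ (by nlinarith)
    nlinarith
  · rw [hv', hr' 3 (by omega), hv, henv]
    simp [State.env, State.setMem, hm, hm', hr, hr']

theorem Implements.cond (e : Expr) {P Q : Prog} {f g : Env → Env} (hP : Implements P f)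
    (hQ : Implements Q g) :
    Implements (.cond e P Q) (fun E => if e.eval E ≠ 0 then f E else g E) := by
  obtain ⟨K, hK⟩ := hP
  obtain ⟨M, hM⟩ := hQ
  obtain ⟨R, hR⟩ := e.exists_exec_compile
  obtain ⟨w, hw⟩ := e.exists_size_eval_le
  refine ⟨K + M + R + w + 1, fun z E h => ⟨?_, fun σ hσ => ?_⟩⟩
  · dsimp only
    split_ifs
    · exact (hK z E h).1.mono (by nlinarith)
    · exact (hM z E h).1.mono (by nlinarith)
  subst hσ
  obtain ⟨t, τ, hx, ht, hm, hr, hv⟩ := hR z 3 σ le_rfl h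
  have henv : τ.env = σ.env := State.env_eq_of_agree hm hr
  have h1 := hw z _ h
  have h2 : w * (z + 1) ≤ w * (z + 1) ^ 2 := Nat.mul_le_mul_left _ (by nlinarith)
  dsimp only
  split_ifs with he
  · obtain ⟨t', τ', hx', ht', hτ'⟩ := (hK z _ h).2 τ henv
    refine ⟨_, τ', hx.seq (Exec.iteTrue (by rwa [hv]) hx'), ?_, hτ'⟩
    rw [hv]
    nlinarith
  · obtain ⟨t', τ', hx', ht', hτ'⟩ := (hM z _ h).2 τ henv
    refine ⟨_, τ', hx.seq (Exec.iteFalse (by rw [hv]; exact not_not.1 he) hx'), ?_, hτ'⟩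
    rw [hv]
    nlinarith

/-- Run a list of programs one after the other. -/
def Prog.all {γ : Type*} (P : γ → Prog) : List γ → Prog
  | [] => .skip
  | c :: l => .seq (P c) (Prog.all P l)

theorem Implements.all {γ : Type*} {P : γ → Prog} {f : γ → Env → Env}
    (h : ∀ c, Implements (P c) (f c)) (l : List γ) :
    Implements (.all P l) (fun E => l.foldl (fun E c => f c E) E) := by
  induction l with
  | nil => exact implements_skip
  | cons c l ih => exact (h c).seq ih

/-- A loop whose body decreases the counter, on visible parts of states that stay small. -/
theorem Implements.exists_runs_loop {P : Prog} {f : Env → Env} (h : Implements P f) :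
    ∃ K, ∀ z E, (∀ i ≤ E.cnt, (f^[i] E).Small z ∧ (f^[i] E).cnt = E.cnt - i) →
      Runs (.loop 2 P) E (K * (E.cnt + 1) * (z + 1) ^ 2) (f^[E.cnt] E) := by
  obtain ⟨K, hK⟩ := h
  -- Iterating the linear growth bound would give an exponential one, so smallness of all iterates
  -- is assumed for a single `z`. The extra `1` pays for the loop test.
  refine ⟨K + 1, fun z E hE => ?_⟩
  generalize hc : E.cnt = c
  induction c generalizing E with
  | zero =>
    intro σ hσ
    have h0 : σ.reg 2 = 0 := by rw [← hc, ← hσ]; rfl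
    refine ⟨_, _, Exec.loopFalse h0, ?_, hσ⟩
    rw [h0, Nat.size_zero]
    exact Nat.succ_le_of_lt (by positivity)
  | succ c ih =>
    intro σ hσ
    have h0 : σ.reg 2 = c + 1 := by rw [← hc, ← hσ]; rfl
    have hs := (hE 0 (Nat.zero_le _)).1
    have h1 := hE 1 (by omega)
    obtain ⟨t, τ, hx, ht, hτ⟩ := (hK z E hs).2 σ hσ
    have hcf : (f E).cnt = c := by
      have := h1.2
      simp only [Function.iterate_one] at this
      omega
    obtain ⟨u, ρ, hy, hu, hρ⟩ := ih (f E) (by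
      intro i hi
      have h2 := hE (i + 1) (by omega)
      rw [Function.iterate_succ_apply] at h2
      exact ⟨h2.1, by rw [h2.2]; omega⟩) hcf τ hτ
    refine ⟨_, _, Exec.loopTrue (by omega) hx hy, ?_, ?_⟩
    · have h3 : (σ.reg 2).size ≤ z := by
        have := hs.cnt
        rw [← hσ] at this
        exact this
      nlinarith
    · rw [hρ, Function.iterate_succ_apply]

end RAM

/-! ### Marking the reachable cells of a table in one pass -/

namespace RAM

namespace Expr

instance : Add Expr := ⟨op .add⟩
instance : Sub Expr := ⟨op .sub⟩
instance : Mul Expr := ⟨op .mul⟩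
instance : Div Expr := ⟨op .div⟩
instance : NatCast Expr := ⟨const⟩

variable (E : Env)

@[simp] theorem eval_add (a b : Expr) : (a + b).eval E = a.eval E + b.eval E := rfl
@[simp] theorem eval_sub (a b : Expr) : (a - b).eval E = a.eval E - b.eval E := rfl
@[simp] theorem eval_mul (a b : Expr) : (a * b).eval E = a.eval E * b.eval E := rfl
@[simp] theorem eval_div (a b : Expr) : (a / b).eval E = a.eval E / b.eval E := rfl
@[simp] theorem eval_natCast (c : ℕ) : (c : Expr).eval E = c := rfl
@[simp] theorem eval_mem (a : Expr) : (mem a).eval E = E.mem (a.eval E) := rfl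
@[simp] theorem eval_acc : acc.eval E = E.acc := rfl
@[simp] theorem eval_cnt : cnt.eval E = E.cnt := rfl

/-- The power of an expression with a fixed exponent. -/
def pow (a : Expr) : ℕ → Expr
  | 0 => (1 : ℕ)
  | k + 1 => a.pow k * a

@[simp] theorem eval_pow (a : Expr) (k : ℕ) : (a.pow k).eval E = a.eval E ^ k := by
  induction k with
  | zero => rfl
  | succ k ih => rw [pow_succ, ← ih]; rfl

/-- An expression that is nonzero exactly when `a ≤ b`. -/
def le (a b : Expr) : Expr := (1 : ℕ) - (a - b)

@[simp] theorem eval_le_ne_zero (a b : Expr) : (a.le b).eval E ≠ 0 ↔ a.eval E ≤ b.eval E := by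
  simp only [le, eval_sub, eval_natCast]
  omega

/-- Tests count as true when nonzero, so products serve as conjunctions and sums as disjunctions. -/
theorem eval_mul_ne_zero (a b : Expr) :
    (a * b).eval E ≠ 0 ↔ a.eval E ≠ 0 ∧ b.eval E ≠ 0 := by
  simp

theorem eval_add_ne_zero (a b : Expr) :
    (a + b).eval E ≠ 0 ↔ a.eval E ≠ 0 ∨ b.eval E ≠ 0 := by
  simp only [eval_add]
  omega

/-- The sum of a finite family of expressions. -/
noncomputable def sum {ι : Type*} [Fintype ι] (f : ι → Expr) : Expr :=
  (Finset.univ.toList.map f).foldr (· + ·) (0 : ℕ)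

@[simp] theorem eval_sum {ι : Type*} [Fintype ι] (f : ι → Expr) :
    (sum f).eval E = ∑ i, (f i).eval E := by
  have h (l : List ι) : ((l.map f).foldr (· + ·) ((0 : ℕ) : Expr)).eval E =
      (l.map fun i => (f i).eval E).sum := by
    induction l with
    | nil => rfl
    | cons a l ih => simp [ih]
  rw [sum, h, Finset.sum_map_toList]

/-- The product of a finite family of expressions. -/
noncomputable def prod {ι : Type*} [Fintype ι] (f : ι → Expr) : Expr :=
  (Finset.univ.toList.map f).foldr (· * ·) (1 : ℕ)

theorem eval_prod_ne_zero {ι : Type*} [Fintype ι] (f : ι → Expr) :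
    (prod f).eval E ≠ 0 ↔ ∀ i, (f i).eval E ≠ 0 := by
  have h (l : List ι) : ((l.map f).foldr (· * ·) ((1 : ℕ) : Expr)).eval E ≠ 0 ↔
      ∀ i ∈ l, (f i).eval E ≠ 0 := by
    induction l with
    | nil => simp
    | cons a l ih => rw [List.map_cons, List.foldr_cons, eval_mul_ne_zero, ih]; simp
  rw [prod, h]
  simp

end Expr

/-- The ingredients of one step of a search: the moves, the address of the current table cell, a
test whether the search goes on there, a test for acceptance otherwise, and for each move a test
whether it is allowed and the address of the table cell to which it leads. -/
structure Search (γ : Type*) where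
  moves : List γ
  addr : Expr
  live : Expr
  accept : Expr
  allowed : γ → Expr
  target : γ → Expr

namespace Search

variable {γ : Type*} (S : Search γ)

/-- Mark the table cells to which the allowed moves lead. -/
def markProg (c : γ) : Prog := .cond (S.allowed c) (.write (S.target c) (1 : ℕ)) .skip

/-- The effect of `markProg`. -/
def mark (c : γ) (E : Env) : Env :=
  if (S.allowed c).eval E ≠ 0 then
    { E with mem := Function.update E.mem ((S.target c).eval E) 1 } else E

/-- One step of the search. -/
def visitProg : Prog :=
  .cond (.mem S.addr)
    (.cond S.live (.all S.markProg S.moves) (.cond S.accept (.const 0 1) .skip)) .skip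

/-- The effect of `visitProg`. -/
def visit (E : Env) : Env :=
  if E.mem (S.addr.eval E) ≠ 0 then
    if S.live.eval E ≠ 0 then S.moves.foldl (fun E c => S.mark c E) E
    else if S.accept.eval E ≠ 0 then { E with ans := 1 } else E
  else E

/-- The loop body. -/
def stepProg : Prog := .seq S.visitProg (.setCnt (.cnt - (1 : ℕ)))

/-- The effect of `stepProg`. -/
def step (E : Env) : Env := { S.visit E with cnt := (S.visit E).cnt - 1 }

theorem implements_stepProg : Implements S.stepProg S.step :=
  have hmark (c : γ) : Implements (S.markProg c) (S.mark c) :=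
    Implements.cond _ (implements_write _ _) implements_skip
  have hvisit : Implements S.visitProg S.visit :=
    Implements.cond _ (Implements.cond _ (Implements.all hmark _)
      (Implements.cond _ (implements_setAns 1) implements_skip)) implements_skip
  hvisit.seq (implements_setCnt _)

/-- The visible part of a state after `t` of `N` steps: the counter has been decreased, the first
working register holds `B`, and the cells below `base` are those of `M`. -/
structure _root_.RAM.Env.At (B N base : ℕ) (M : ℕ → ℕ) (t : ℕ) (E : Env) : Prop where
  acc : E.acc = B
  cnt : E.cnt = N - t
  mem : ∀ x < base, E.mem x = M x

/-- The expressions of a search compute the functions and relations that they should. -/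
structure Spec (B N base : ℕ) (M : ℕ → ℕ) (live accept : ℕ → Prop) (allowed : ℕ → γ → Prop)
    (next : ℕ → γ → ℕ) : Prop where
  addr_eval : ∀ t < N, ∀ E : Env, E.At B N base M t → S.addr.eval E = base + t
  live_eval : ∀ t < N, ∀ E : Env, E.At B N base M t → (S.live.eval E ≠ 0 ↔ live t)
  accept_eval : ∀ t < N, ∀ E : Env, E.At B N base M t → ¬ live t →
    (S.accept.eval E ≠ 0 ↔ accept t)
  allowed_eval : ∀ t < N, ∀ E : Env, E.At B N base M t → live t → ∀ c,
    ((S.allowed c).eval E ≠ 0 ↔ allowed t c)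
  target_eval : ∀ t < N, ∀ E : Env, E.At B N base M t → live t → ∀ c,
    (S.target c).eval E = base + next t c
  lt_next : ∀ t c, t < next t c

/-- The table cells that can be reached from the cell `0`. -/
inductive Reach (l : List γ) (live : ℕ → Prop) (allowed : ℕ → γ → Prop) (next : ℕ → γ → ℕ) :
    ℕ → Prop
  | zero : Reach l live allowed next 0
  | step {t : ℕ} {c : γ} : Reach l live allowed next t → live t → c ∈ l → allowed t c →
      Reach l live allowed next (next t c)

variable {S} {B N base : ℕ} {M : ℕ → ℕ} {live accept : ℕ → Prop} {allowed : ℕ → γ → Prop}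
  {next : ℕ → γ → ℕ}

theorem mark_small {z : ℕ} (hz : 1 ≤ z) (c : γ) {E : Env} (h : E.Small z) :
    (S.mark c E).Small z := by
  rw [mark]
  split_ifs
  · refine ⟨h.acc, h.cnt, fun a => ?_⟩
    dsimp only
    rw [Function.update_apply]
    split_ifs
    · simpa using hz
    · exact h.mem a
  · exact h

theorem marks_small {z : ℕ} (hz : 1 ≤ z) (l : List γ) {E : Env} (h : E.Small z) :
    (l.foldl (fun E c => S.mark c E) E).Small z := by
  induction l generalizing E with
  | nil => exact h
  | cons c l ih => exact ih (mark_small hz c h)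

theorem visit_small {z : ℕ} (hz : 1 ≤ z) {E : Env} (h : E.Small z) : (S.visit E).Small z := by
  rw [visit]
  split_ifs
  · exact marks_small hz _ h
  · exact ⟨h.acc, h.cnt, h.mem⟩
  · exact h
  · exact h

/-- Only the number `1` is written to memory and the counter does not grow, so the same `z` serves
for all rounds, as the loop bound requires. -/
theorem step_small {z : ℕ} (hz : 1 ≤ z) {E : Env} (h : E.Small z) : (S.step E).Small z :=
  have h' := visit_small (S := S) hz h
  ⟨h'.acc, (Nat.size_le_size (Nat.sub_le _ _)).trans h'.cnt, h'.mem⟩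

namespace Spec

variable (hS : S.Spec B N base M live accept allowed next)

include hS in
-- Targets lie at or above `base`, so the input below survives every mark.
theorem mark_spec {t : ℕ} (ht : t < N) (hl : live t) (c : γ) {E : Env} (hE : E.At B N base M t) :
    (S.mark c E).At B N base M t ∧ (S.mark c E).ans = E.ans ∧
      ∀ x, (S.mark c E).mem (base + x) ≠ 0 ↔
        E.mem (base + x) ≠ 0 ∨ allowed t c ∧ x = next t c := by
  have h1 := hS.allowed_eval t ht E hE hl c
  have h2 := hS.target_eval t ht E hE hl c
  rw [mark]
  split_ifs with h
  · refine ⟨⟨hE.acc, hE.cnt, fun x hx => ?_⟩, rfl, fun x => ?_⟩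
    · rw [← hE.mem x hx]
      exact Function.update_of_ne (by omega) _ _
    · dsimp only
      rw [Function.update_apply, h2]
      have h3 := h1.1 h
      split_ifs with h4
      · simp only [ne_eq, one_ne_zero, not_false_eq_true, true_iff]
        exact Or.inr ⟨h3, by omega⟩
      · have h5 : x ≠ next t c := by omega
        simp [h5]
  · have h3 : ¬ allowed t c := fun h3 => h (h1.2 h3)
    exact ⟨hE, rfl, fun x => by simp [h3]⟩

include hS in
theorem marks_spec {t : ℕ} (ht : t < N) (hl : live t) (l : List γ) {E : Env}
    (hE : E.At B N base M t) :
    (l.foldl (fun E c => S.mark c E) E).At B N base M t ∧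
      (l.foldl (fun E c => S.mark c E) E).ans = E.ans ∧
      ∀ x, (l.foldl (fun E c => S.mark c E) E).mem (base + x) ≠ 0 ↔
        E.mem (base + x) ≠ 0 ∨ ∃ c ∈ l, allowed t c ∧ x = next t c := by
  induction l generalizing E with
  | nil => exact ⟨hE, rfl, fun x => by simp⟩
  | cons c l ih =>
    obtain ⟨h1, h2, h3⟩ := hS.mark_spec ht hl c hE
    obtain ⟨h4, h5, h6⟩ := ih h1
    refine ⟨h4, h5.trans h2, fun x => ?_⟩
    rw [List.foldl_cons, h6, h3]
    simp only [List.mem_cons, exists_eq_or_imp, or_assoc]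

open Classical in
include hS in
/-- After `t` steps the marked cells are those with an allowed move from a reachable cell among the
first `t` ones. -/
theorem iterate_spec {E : Env} (hE : E.At B N base M 0) (hans : E.ans = 0)
    (hmem : ∀ x, E.mem (base + x) ≠ 0 ↔ x = 0) {t : ℕ} (ht : t ≤ N) :
    (S.step^[t] E).At B N base M t ∧
      (S.step^[t] E).ans =
        (if ∃ y < t, Reach S.moves live allowed next y ∧ ¬ live y ∧ accept y then 1 else 0) ∧
      ∀ x, (S.step^[t] E).mem (base + x) ≠ 0 ↔
        x = 0 ∨ ∃ y < t, Reach S.moves live allowed next y ∧ live y ∧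
          ∃ c ∈ S.moves, allowed y c ∧ x = next y c := by
  induction t with
  | zero => exact ⟨hE, by simpa using hans, fun x => by simpa using hmem x⟩
  | succ t ih =>
    obtain ⟨h1, h2, h3⟩ := ih (by omega)
    rw [Function.iterate_succ_apply']
    generalize S.step^[t] E = E' at h1 h2 h3 ⊢
    have ht' : t < N := by omega
    -- Moves strictly increase the position (`lt_next`), so any move into cell `t` comes from a cell
    -- already visited, and the mark of `t` is final now.
    have hreach : E'.mem (base + t) ≠ 0 ↔ Reach S.moves live allowed next t := by
      rw [h3]
      constructor
      · rintro (rfl | ⟨y, _, hy, hl, c, hc, ha, rfl⟩)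
        · exact .zero
        · exact .step hy hl hc ha
      · intro h
        cases h with
        | zero => exact Or.inl rfl
        | step hy hl hc ha => exact Or.inr ⟨_, hS.lt_next _ _, hy, hl, _, hc, ha, rfl⟩
    have hsucc (p : ℕ → Prop) : (∃ y < t + 1, p y) ↔ (∃ y < t, p y) ∨ p t := by
      constructor
      · rintro ⟨y, hy, h⟩
        rcases Nat.lt_succ_iff_lt_or_eq.1 hy with hy | rfl
        · exact Or.inl ⟨y, hy, h⟩
        · exact Or.inr h
      · rintro (⟨y, hy, h⟩ | h)
        · exact ⟨y, by omega, h⟩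
        · exact ⟨t, by omega, h⟩
    suffices hv : (S.visit E').At B N base M t ∧
        (S.visit E').ans = (if ∃ y < t + 1, Reach S.moves live allowed next y ∧ ¬ live y ∧ accept y
          then 1 else 0) ∧
        ∀ x, (S.visit E').mem (base + x) ≠ 0 ↔
          x = 0 ∨ ∃ y < t + 1, Reach S.moves live allowed next y ∧ live y ∧
            ∃ c ∈ S.moves, allowed y c ∧ x = next y c by
      obtain ⟨h4, h5, h6⟩ := hv
      refine ⟨⟨h4.acc, ?_, h4.mem⟩, h5, h6⟩
      simp only [step, h4.cnt]
      omega
    have haddr := hS.addr_eval t ht' E' h1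
    have hlive := hS.live_eval t ht' E' h1
    simp only [hsucc]
    rw [visit, haddr]
    by_cases h4 : Reach S.moves live allowed next t
    · rw [if_pos (hreach.2 h4)]
      by_cases h5 : live t
      · rw [if_pos (hlive.2 h5)]
        obtain ⟨h8, h9, h10⟩ := hS.marks_spec ht' h5 S.moves h1
        refine ⟨h8, ?_, fun x => ?_⟩
        · simp [h9, h2, h5]
        · simp [h10, h3, h4, h5, or_assoc]
      · rw [if_neg (fun h => h5 (hlive.1 h))]
        by_cases h6 : accept t
        · rw [if_pos ((hS.accept_eval t ht' E' h1 h5).2 h6)]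
          exact ⟨⟨h1.acc, h1.cnt, h1.mem⟩, by simp [h4, h5, h6], fun x => by simp [h3, h5]⟩
        · rw [if_neg (fun h => h6 ((hS.accept_eval t ht' E' h1 h5).1 h))]
          exact ⟨h1, by simp [h2, h6], fun x => by simp [h3, h5]⟩
    · rw [if_neg (fun h => h4 (hreach.1 h))]
      exact ⟨h1, by simp [h2, h4], fun x => by simp [h3, h4]⟩

end Spec

end Search

end RAM

/-! ### A common witness form of the fairness notions -/

namespace FairDivision

/-- The notions in which the removed item must not depend on the envious agent. -/
def Notion.strong : Notion → Bool
  | .sEF1 | .swEF1 => true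
  | _ => false

/-- Numerators of the weights that matter. -/
def Notion.num (F : Notion) {n : ℕ} (w : Fin n → ℚ) (i : Fin n) : ℕ :=
  if F.weighted then (w i).num.toNat else 1

/-- Denominators of the weights that matter. -/
def Notion.den (F : Notion) {n : ℕ} (w : Fin n → ℚ) (i : Fin n) : ℕ :=
  if F.weighted then (w i).den else 1

/-- The condition that a fairness notion puts on two agents with weights `p / q` and `p' / q'`, in
an instance with `m` items: the first agent has value `own` for her bundle, value `other` for that
of the second one, and value `wit` for a set of `card ≤ 1` items in the latter. -/
def Notion.Local (F : Notion) (m p q p' q' own other card wit : ℕ) : Prop :=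
  match F with
  | .EF => other ≤ own
  | .EFL => other - wit ≤ 0 ∨ 1 ≤ card ∧ other - wit ≤ own ∧ wit ≤ own
  | .tEF1 => other ≤ own ∨ 1 ≤ card ∧ other - wit ≤ own + wit
  | .EF1 | .sEF1 | .wEF1 | .swEF1 => 1 ≤ m ∧ (other - wit) * (q' * p) ≤ own * (q * p')

namespace Instance

variable {n : ℕ} (I : Instance n)

theorem val_mono (i : Fin n) {S T : Finset (Fin I.m)} (h : S ⊆ T) : I.val i S ≤ I.val i T :=
  Finset.sum_le_sum_of_subset h

theorem val_sdiff (i : Fin n) {S T : Finset (Fin I.m)} (h : S ⊆ T) :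
    I.val i (T \ S) = I.val i T - I.val i S := by
  have : I.val i (T \ S) + I.val i S = I.val i T := Finset.sum_sdiff h
  omega

/-- Removing an item outside `T` amounts to the empty witness. Conversely an empty witness may be
replaced by any item because `P` passes to subsets, but some item must exist; this is the role of `1
≤ I.m`. -/
theorem exists_removal_iff (T : Finset (Fin I.m)) {P : Finset (Fin I.m) → Prop}
    (hP : ∀ S S', S ⊆ S' → P S' → P S) :
    (∃ g, P (T \ {g})) ↔ ∃ Y, (Y ⊆ T ∧ Y.card ≤ 1) ∧ 1 ≤ I.m ∧ P (T \ Y) := by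
  constructor
  · rintro ⟨g, hg⟩
    refine ⟨T ∩ {g}, ⟨Finset.inter_subset_left, ?_⟩, ?_, ?_⟩
    · exact (Finset.card_le_card Finset.inter_subset_right).trans (Finset.card_singleton g).le
    · have := g.isLt; omega
    · rwa [Finset.sdiff_inter_self_left]
  · rintro ⟨Y, ⟨_, hc⟩, hm, h⟩
    have : Nonempty (Fin I.m) := ⟨⟨0, hm⟩⟩
    rcases Finset.card_le_one_iff_subset_singleton (s := Y) |>.1 hc with ⟨g, hg⟩
    exact ⟨g, hP _ _ (Finset.sdiff_subset_sdiff subset_rfl hg) h⟩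

theorem exists_weak_family_iff {α : Type*} {b : Bool} (hb : b = false)
    (P : Fin n → Fin n → α → Prop) :
    (∃ Z : Fin n → Fin n → α, (b = true → ∀ i i' j, Z i j = Z i' j) ∧ ∀ i j, P i j (Z i j)) ↔
      ∀ i j, ∃ Y, P i j Y := by
  subst hb
  refine ⟨fun ⟨Z, _, h⟩ i j => ⟨Z i j, h i j⟩, fun h => ?_⟩
  choose Z hZ using h
  exact ⟨Z, nofun, hZ⟩

theorem exists_strong_family_iff {α : Type*} {b : Bool} (hb : b = true)
    (P : Fin n → Fin n → α → Prop) :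
    (∃ Z : Fin n → Fin n → α, (b = true → ∀ i i' j, Z i j = Z i' j) ∧ ∀ i j, P i j (Z i j)) ↔
      ∀ j, ∃ Y, ∀ i, P i j Y := by
  constructor
  · rintro ⟨Z, h, h'⟩ j
    exact ⟨Z j j, fun i => h hb i j j ▸ h' i j⟩
  · intro h
    choose Z hZ using h
    exact ⟨fun _ => Z, fun _ _ _ _ => rfl, fun i j => hZ j i⟩

/-- Clearing denominators turns the weighted comparison into one of natural numbers, which the
machine can evaluate. -/
theorem div_le_div_iff_weights {x y : ℕ} {a b : ℚ} (ha : 0 < a) (hb : 0 < b) :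
    (x : ℚ) / b ≤ y / a ↔ x * (b.den * a.num.toNat) ≤ y * (a.den * b.num.toNat) := by
  have key (c : ℚ) (hc : 0 < c) : (c.num.toNat : ℚ) = c * c.den := by
    have h : ((c.num.toNat : ℤ) : ℚ) = (c.num : ℚ) := by
      rw [Int.toNat_of_nonneg (Rat.num_pos.2 hc).le]
    rw [← Rat.mul_den_eq_num c] at h
    exact_mod_cast h
  rw [div_le_div_iff₀ hb ha, ← @Nat.cast_le ℚ]
  push_cast
  rw [key a ha, key b hb]
  have hd : (0 : ℚ) < a.den * b.den := by
    have := a.den_pos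
    have := b.den_pos
    positivity
  rw [← mul_le_mul_iff_left₀ hd]
  ring_nf

variable {I}

/-- The items of positive value form the witness; conversely, every such item must lie in a set
whose removal leaves value zero. -/
theorem card_filter_le_one_iff (i : Fin n) (T : Finset (Fin I.m)) :
    (T.filter fun g => 0 < I.v i g).card ≤ 1 ↔
      ∃ Y, (Y ⊆ T ∧ Y.card ≤ 1) ∧ I.val i (T \ Y) ≤ 0 := by
  constructor
  · refine fun h => ⟨_, ⟨Finset.filter_subset _ _, h⟩, (Finset.sum_eq_zero fun g hg => ?_).le⟩
    simp only [Finset.mem_sdiff, Finset.mem_filter, not_and, not_lt] at hg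
    have := hg.2 hg.1
    omega
  · rintro ⟨Y, ⟨_, hc⟩, h⟩
    refine (Finset.card_le_card fun g hg => ?_).trans hc
    rw [Finset.mem_filter] at hg
    by_contra hgY
    have h1 := Finset.sum_eq_zero_iff.1 (Nat.le_zero.1 h) g (Finset.mem_sdiff.2 ⟨hg.1, hgY⟩)
    omega

theorem exists_mem_iff_exists_card_eq_one {α : Type*} [DecidableEq α] (T : Finset α)
    (P : Finset α → Prop) :
    (∃ g ∈ T, P {g}) ↔ ∃ Y, (Y ⊆ T ∧ Y.card ≤ 1) ∧ 1 ≤ Y.card ∧ P Y := by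
  constructor
  · rintro ⟨g, hg, h⟩
    exact ⟨{g}, ⟨Finset.singleton_subset_iff.2 hg, by simp⟩, by simp, h⟩
  · rintro ⟨Y, ⟨hY, h1⟩, h2, h⟩
    obtain ⟨g, rfl⟩ := Finset.card_eq_one.1 (le_antisymm h1 h2)
    exact ⟨g, Finset.singleton_subset_iff.1 hY, h⟩

theorem exists_subset_or_iff {α : Type*} [DecidableEq α] (T : Finset α) (a : Prop)
    (P : Finset α → Prop) :
    (∃ Y, (Y ⊆ T ∧ Y.card ≤ 1) ∧ (a ∨ P Y)) ↔ a ∨ ∃ Y, (Y ⊆ T ∧ Y.card ≤ 1) ∧ P Y := by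
  constructor
  · rintro ⟨Y, hY, h | h⟩
    exacts [Or.inl h, Or.inr ⟨Y, hY, h⟩]
  · rintro (h | ⟨Y, hY, h⟩)
    exacts [⟨∅, by simp, Or.inl h⟩, ⟨Y, hY, Or.inr h⟩]

theorem weighted_removal_iff {w : Fin n → ℚ} (hw : ∀ i, 0 < w i) (i j : Fin n)
    {S T Y : Finset (Fin I.m)} (hY : Y ⊆ T) :
    (I.val i (T \ Y) : ℚ) / w j ≤ (I.val i S : ℚ) / w i ↔
      (I.val i T - I.val i Y) * ((w j).den * (w i).num.toNat) ≤
        I.val i S * ((w i).den * (w j).num.toNat) := by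
  rw [div_le_div_iff_weights (hw i) (hw j), I.val_sdiff i hY]

theorem weighted_antitone {w : Fin n → ℚ} (hw : ∀ i, 0 < w i) (i j : Fin n) (c : ℚ)
    (S S' : Finset (Fin I.m)) (h : S ⊆ S') (h' : (I.val i S' : ℚ) / w j ≤ c) :
    (I.val i S : ℚ) / w j ≤ c := by
  refine le_trans ?_ h'
  have := hw j
  have := I.val_mono i h
  gcongr

/-- The set `Y` of at most one item in the bundle of `j` shows that the notion is fulfilled for the
agents `i` and `j`. -/
def IsWitness (I : Instance n) (F : Notion) (w : Fin n → ℚ) (A : Fin n → Finset (Fin I.m))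
    (i j : Fin n) (Y : Finset (Fin I.m)) : Prop :=
  (Y ⊆ A j ∧ Y.card ≤ 1) ∧
    F.Local I.m (F.num w i) (F.den w i) (F.num w j) (F.den w j) (I.val i (A i))
      (I.val i (A j)) Y.card (I.val i Y)

/-- This reduces all notions to one shape. The quantifier order "one item for all `i`" of the strong
notions becomes the independence of `Z i j` from `i`. -/
theorem isFair_iff {w : Fin n → ℚ} (hw : ∀ i, 0 < w i) (F : Notion)
    {A : Fin n → Finset (Fin I.m)} (hA : I.IsAllocation A) :
    I.IsFair w F A ↔ ∃ Z : Fin n → Fin n → Finset (Fin I.m),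
      (F.strong = true → ∀ i i' j, Z i j = Z i' j) ∧
      ∀ i j, I.IsWitness F w A i j (Z i j) := by
  cases F with
  | EF =>
    rw [exists_weak_family_iff (b := Notion.EF.strong) rfl (I.IsWitness .EF w A)]
    simp only [IsWitness, Notion.Local, IsFair, Instance.EF]
    refine forall₂_congr fun i j => ⟨fun h => ⟨∅, by simp, h⟩, fun ⟨_, _, h⟩ => h⟩
  | EFL =>
    rw [exists_weak_family_iff (b := Notion.EFL.strong) rfl (I.IsWitness .EFL w A)]
    simp only [IsWitness, Notion.Local, IsFair, Instance.EFL]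
    refine forall₂_congr fun i j => ?_
    rw [card_filter_le_one_iff, exists_mem_iff_exists_card_eq_one (A j)
      (fun Y => I.val i (A j \ Y) ≤ I.val i (A i) ∧ I.val i Y ≤ I.val i (A i)), ← exists_or]
    refine exists_congr fun Y => ?_
    rw [← and_or_left]
    exact and_congr_right fun hY => by rw [I.val_sdiff i hY.1]
  | tEF1 =>
    rw [exists_weak_family_iff (b := Notion.tEF1.strong) rfl (I.IsWitness .tEF1 w A)]
    simp only [IsWitness, Notion.Local, IsFair, Instance.TEF1]
    refine forall₂_congr fun i j => ?_
    rw [exists_subset_or_iff, exists_mem_iff_exists_card_eq_one (A j)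
      (fun Y => I.val i (A j \ Y) ≤ I.val i (A i ∪ Y)), ← not_lt, ← imp_iff_not_or]
    refine imp_congr_right fun hlt => exists_congr fun Y => and_congr_right fun hY => ?_
    -- Envy is strict here, hence the agents differ, their bundles are disjoint, and the transferred
    -- item adds its full value.
    have hij : i ≠ j := fun h => by subst h; exact lt_irrefl _ hlt
    have : I.val i (A i ∪ Y) = I.val i (A i) + I.val i Y :=
      Finset.sum_union ((hA.1 i j hij).mono_right hY.1)
    rw [this, I.val_sdiff i hY.1]
  | EF1 =>
    rw [exists_weak_family_iff (b := Notion.EF1.strong) rfl (I.IsWitness .EF1 w A)]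
    simp only [IsWitness, Notion.Local, IsFair, Instance.EF1, Notion.num, Notion.den, Notion.weighted, Bool.false_eq_true, if_false,
      mul_one]
    refine forall₂_congr fun i j => ?_
    rw [I.exists_removal_iff (A j) (fun S S' h h' => (I.val_mono i h).trans h')]
    exact exists_congr fun Y => and_congr_right fun hY => by rw [I.val_sdiff i hY.1]
  | sEF1 =>
    rw [exists_strong_family_iff (b := Notion.sEF1.strong) rfl (I.IsWitness .sEF1 w A)]
    simp only [IsWitness, Notion.Local, IsFair, Instance.SEF1, Notion.num, Notion.den, Notion.weighted,
      Bool.false_eq_true, if_false, mul_one]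
    refine forall_congr' fun j => ?_
    rw [I.exists_removal_iff (A j) (P := fun S => ∀ i, I.val i S ≤ I.val i (A i))
      (fun S S' h h' i => (I.val_mono i h).trans (h' i))]
    -- The parts that do not mention `i` are extracted at `i = j`, an agent that certainly exists.
    refine exists_congr fun Y => ⟨fun ⟨hY, hm, h⟩ i => ⟨hY, hm, ?_⟩, fun h =>
      ⟨(h j).1, (h j).2.1, fun i => ?_⟩⟩
    · rw [← I.val_sdiff i hY.1]; exact h i
    · rw [I.val_sdiff i (h j).1.1]; exact (h i).2.2
  | wEF1 =>
    rw [exists_weak_family_iff (b := Notion.wEF1.strong) rfl (I.IsWitness .wEF1 w A)]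
    simp only [IsWitness, Notion.Local, IsFair, Instance.WEF1, Notion.num, Notion.den, Notion.weighted, if_true]
    refine forall₂_congr fun i j => ?_
    rw [I.exists_removal_iff (A j) (weighted_antitone hw i j _)]
    exact exists_congr fun Y => and_congr_right fun hY => by rw [weighted_removal_iff hw i j hY.1]
  | swEF1 =>
    rw [exists_strong_family_iff (b := Notion.swEF1.strong) rfl (I.IsWitness .swEF1 w A)]
    simp only [IsWitness, Notion.Local, IsFair, Instance.SWEF1, Notion.num, Notion.den, Notion.weighted, if_true]
    refine forall_congr' fun j => ?_
    rw [I.exists_removal_iff (A j)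
      (P := fun S => ∀ i, (I.val i S : ℚ) / w j ≤ (I.val i (A i) : ℚ) / w i)
      (fun S S' h h' i => weighted_antitone hw i j _ S S' h (h' i))]
    refine exists_congr fun Y => ⟨fun ⟨hY, hm, h⟩ i => ⟨hY, hm, ?_⟩, fun h =>
      ⟨(h j).1, (h j).2.1, fun i => ?_⟩⟩
    · rw [← weighted_removal_iff hw i j hY.1]; exact h i
    · rw [weighted_removal_iff hw i j (h j).1.1]; exact (h i).2.2

/-! ### Owner functions and the dynamic program -/

/-- The bundles of the allocation that gives each item `g` to the agent `o g`. -/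
def bundles (o : Fin I.m → Fin n) (j : Fin n) : Finset (Fin I.m) :=
  Finset.univ.filter fun g => o g = j

@[simp] theorem mem_bundles (o : Fin I.m → Fin n) (j : Fin n) (g : Fin I.m) :
    g ∈ bundles o j ↔ o g = j := by simp [bundles]

theorem isAllocation_bundles (o : Fin I.m → Fin n) : I.IsAllocation (bundles o) := by
  refine ⟨fun i j hij => ?_, fun g => ⟨o g, by simp⟩⟩
  rw [Finset.disjoint_left]
  intro g hi hj
  rw [mem_bundles] at hi hj
  exact hij (hi.symm.trans hj)

theorem IsAllocation.exists_eq_bundles {A : Fin n → Finset (Fin I.m)} (hA : I.IsAllocation A) :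
    ∃ o, A = bundles o := by
  choose o ho using hA.2
  refine ⟨o, funext fun j => Finset.ext fun g => ?_⟩
  rw [mem_bundles]
  refine ⟨fun h => ?_, fun h => h ▸ ho g⟩
  by_contra hne
  exact Finset.disjoint_left.1 (hA.1 _ _ hne) (ho g) h

theorem SI_bundles (o : Fin I.m → Fin n) : I.SI (bundles o) = ∑ g, I.s (o g) g := by
  unfold SI impact bundles
  rw [← Finset.sum_fiberwise Finset.univ o]
  refine Finset.sum_congr rfl fun j _ => Finset.sum_congr rfl fun g hg => ?_
  rw [(Finset.mem_filter.1 hg).2]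

/-- The total impact separates over items: reassigning a single item shows necessity, and summing
the itemwise inequalities shows sufficiency. -/
theorem isSIM_bundles_iff (o : Fin I.m → Fin n) :
    I.IsSIM (bundles o) ↔ ∀ g i, I.s i g ≤ I.s (o g) g := by
  constructor
  · rintro ⟨_, h⟩ g i
    have h1 := h _ (isAllocation_bundles (Function.update o g i))
    rw [SI_bundles, SI_bundles, ← Finset.add_sum_erase _ _ (Finset.mem_univ g),
      ← Finset.add_sum_erase _ (fun g => I.s (o g) g) (Finset.mem_univ g)] at h1
    have h2 : ∑ x ∈ Finset.univ.erase g, I.s (Function.update o g i x) x =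
        ∑ x ∈ Finset.univ.erase g, I.s (o x) x :=
      Finset.sum_congr rfl fun x hx => by rw [Function.update_of_ne (Finset.ne_of_mem_erase hx)]
    rw [h2, Function.update_self] at h1
    omega
  · refine fun h => ⟨isAllocation_bundles o, fun A' hA' => ?_⟩
    obtain ⟨o', rfl⟩ := hA'.exists_eq_bundles
    rw [SI_bundles, SI_bundles]
    exact Finset.sum_le_sum fun g _ => h g _

/-- The moves of the dynamic program: an item goes to an agent `j`, and a set of agents is chosen
for which it is the witness in the bundle of `j`. -/
abbrev Move (n : ℕ) := Fin n × Finset (Fin n)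

/-- The moves that are allowed for an item. -/
def Allowed (F : Notion) (I : Instance n) (g : Fin I.m) (c : Move n) : Prop :=
  (∀ i, I.s i g ≤ I.s c.1 g) ∧ (F.strong = true → c.2 = ∅ ∨ c.2 = Finset.univ)

/-- The contribution of a move to the digits of the dynamic program: for agents `i` and `j`, the
value for `i` of the bundle of `j`, the number of the witnesses for `i` in this bundle, and the
value for `i` of these witnesses. -/
def gain (v : Fin n → ℕ) (c : Move n) : Fin n × Fin n × Fin 3 → ℕ
  | (i, j, 0) => if j = c.1 then v i else 0
  | (i, j, 1) => if j = c.1 ∧ i ∈ c.2 then 1 else 0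
  | (i, j, 2) => if j = c.1 ∧ i ∈ c.2 then v i else 0

/-- The acceptance condition on the digits. -/
def Accepts (F : Notion) (m : ℕ) (p q : Fin n → ℕ) (x : Fin n × Fin n × Fin 3 → ℕ) : Prop :=
  ∀ i j, x (i, j, 1) ≤ 1 ∧
    F.Local m (p i) (q i) (p j) (q j) (x (i, i, 0)) (x (i, j, 0)) (x (i, j, 1)) (x (i, j, 2))

theorem sum_gain_zero (f : Fin I.m → Move n) (i j : Fin n) :
    ∑ g, gain (I.v · g) (f g) (i, j, 0) = I.val i (bundles (fun g => (f g).1) j) := by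
  rw [val, bundles, Finset.sum_filter]
  exact Finset.sum_congr rfl fun g _ => by simp [gain, eq_comm]

theorem sum_gain_one (f : Fin I.m → Move n) (i j : Fin n) :
    ∑ g, gain (I.v · g) (f g) (i, j, 1) =
      (Finset.univ.filter fun g => j = (f g).1 ∧ i ∈ (f g).2).card := by
  rw [Finset.card_filter]
  exact Finset.sum_congr rfl fun g _ => by simp [gain]

theorem sum_gain_two (f : Fin I.m → Move n) (i j : Fin n) :
    ∑ g, gain (I.v · g) (f g) (i, j, 2) =
      I.val i (Finset.univ.filter fun g => j = (f g).1 ∧ i ∈ (f g).2) := by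
  rw [val, Finset.sum_filter]
  exact Finset.sum_congr rfl fun g _ => by simp [gain]

/-- The dynamic program finds the fair allocations of maximal social impact. -/
theorem exists_isSIM_isFair_iff {w : Fin n → ℚ} (hw : ∀ i, 0 < w i) (F : Notion) :
    (∃ A, I.IsSIM A ∧ I.IsFair w F A) ↔ ∃ f : Fin I.m → Move n, (∀ g, Allowed F I g (f g)) ∧
      Accepts F I.m (F.num w) (F.den w) (fun p => ∑ g, gain (I.v · g) (f g) p) := by
  constructor
  · rintro ⟨A, hA, hF⟩
    obtain ⟨o, rfl⟩ := hA.1.exists_eq_bundles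
    obtain ⟨Z, hs, hZ⟩ := (isFair_iff hw F hA.1).1 hF
    rw [isSIM_bundles_iff] at hA
    -- An item can be a witness only in the bundle of its owner, so a set of agents per item records
    -- all of `Z`. If `Z` does not depend on the envious agent, this set is empty or everything.
    refine ⟨fun g => (o g, Finset.univ.filter fun i => g ∈ Z i (o g)), fun g => ⟨hA g, fun h => ?_⟩,
      fun i j => ?_⟩
    · by_cases hg : g ∈ Z (o g) (o g)
      · right
        ext i
        simp [hs h i (o g), hg]
      · left
        ext i
        simp [hs h i (o g), hg]
    · dsimp only
      rw [sum_gain_zero, sum_gain_zero, sum_gain_one, sum_gain_two]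
      have h : (Finset.univ.filter fun g => j = o g ∧
          i ∈ (Finset.univ.filter fun i => g ∈ Z i (o g))) = Z i j := by
        ext g
        simp only [Finset.mem_filter, Finset.mem_univ, true_and]
        constructor
        · rintro ⟨rfl, h⟩
          exact h
        · intro h
          have := (mem_bundles _ _ _).1 ((hZ i j).1.1 h)
          subst this
          exact ⟨rfl, h⟩
      rw [h]
      exact ⟨(hZ i j).1.2, (hZ i j).2⟩
  · rintro ⟨f, hf, h⟩
    have hA := isAllocation_bundles fun g => (f g).1
    -- The witness sets are read off from the moves; digit `1` counts their elements, so acceptance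
    -- bounds their size by one.
    refine ⟨bundles fun g => (f g).1, (isSIM_bundles_iff _).2 fun g => (hf g).1,
      (isFair_iff hw F hA).2 ⟨fun i j => Finset.univ.filter fun g => j = (f g).1 ∧ i ∈ (f g).2,
        fun hs i i' j => ?_, fun i j => ⟨⟨fun g hg => ?_, ?_⟩, ?_⟩⟩⟩
    · ext g
      rcases (hf g).2 hs with h | h <;> simp [h]
    · rw [mem_bundles]
      exact (Finset.mem_filter.1 hg).2.1.symm
    · rw [← sum_gain_one]
      exact (h i j).1
    · rw [← sum_gain_one, ← sum_gain_two, ← sum_gain_zero, ← sum_gain_zero]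
      exact (h i j).2

end Instance

end FairDivision

/-! ### Tables that are searched row by row -/

namespace RAM.Search

variable {γ : Type*}

/-- Cells that are reached row by row: a path to row `g` consists of one move for each row before,
and the position in the row is the sum of the contributions of these moves. -/
theorem reach_rows_iff [Nonempty γ] (l : List γ) {m Q : ℕ} (ok : ℕ → γ → Prop) (d : ℕ → γ → ℕ)
    (hd : ∀ g ≤ m, ∀ f : ℕ → γ, ∑ k ∈ Finset.range g, d k (f k) < Q) (x : ℕ) :
    Reach l (fun t => t / Q < m) (fun t => ok (t / Q)) (fun t c => t + Q + d (t / Q) c) x ↔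
      ∃ g ≤ m, ∃ f : ℕ → γ, (∀ k < g, f k ∈ l ∧ ok k (f k)) ∧
        x = g * Q + ∑ k ∈ Finset.range g, d k (f k) := by
  -- A sum of contributions never overflows a row, so division by `Q` recovers the number of moves
  -- made.
  have hdiv {g : ℕ} (hg : g ≤ m) (f : ℕ → γ) :
      (g * Q + ∑ k ∈ Finset.range g, d k (f k)) / Q = g := by
    have h := hd g hg f
    rw [Nat.add_comm, Nat.add_mul_div_right _ _ (by omega), Nat.div_eq_of_lt h, zero_add]
  constructor
  · intro h
    induction h with
    | zero => exact ⟨0, Nat.zero_le _, fun _ => Classical.arbitrary γ, nofun, by simp⟩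
    | @step t c _ hl hc ha ih =>
      obtain ⟨g, hg, f, hf, rfl⟩ := ih
      rw [hdiv hg f] at hl ha
      refine ⟨g + 1, hl, Function.update f g c, fun k hk => ?_, ?_⟩
      · rcases Nat.lt_succ_iff_lt_or_eq.1 hk with hk | rfl
        · rw [Function.update_of_ne hk.ne]
          exact hf k hk
        · rw [Function.update_self]
          exact ⟨hc, ha⟩
      · rw [hdiv hg f, Finset.sum_range_succ, Function.update_self]
        have : ∑ k ∈ Finset.range g, d k (Function.update f g c k) =
            ∑ k ∈ Finset.range g, d k (f k) :=
          Finset.sum_congr rfl fun k hk => by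
            rw [Function.update_of_ne (Finset.mem_range.1 hk).ne]
        rw [this]
        ring
  · rintro ⟨g, hg, f, hf, rfl⟩
    induction g with
    | zero => simpa using Reach.zero
    | succ g ih =>
      have hr := ih (by omega) fun k hk => hf k (by omega)
      have hg' : (g * Q + ∑ k ∈ Finset.range g, d k (f k)) / Q = g := hdiv (by omega) f
      have h := Reach.step (c := f g) hr (by rw [hg']; omega) (hf g (by omega)).1
        (by rw [hg']; exact (hf g (by omega)).2)
      rw [hg'] at h
      convert h using 1
      rw [Finset.sum_range_succ]
      ring

/-- Only row `m` is not live, and it is reached exactly by complete paths; reduction modulo `Q`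
strips the row number and leaves the sum of contributions. -/
theorem exists_accepted_iff [Nonempty γ] (l : List γ) {m Q : ℕ} (ok : ℕ → γ → Prop)
    (d : ℕ → γ → ℕ) (hd : ∀ g ≤ m, ∀ f : ℕ → γ, ∑ k ∈ Finset.range g, d k (f k) < Q)
    (accept : ℕ → Prop) :
    (∃ y < (m + 1) * Q, Reach l (fun t => t / Q < m) (fun t => ok (t / Q))
        (fun t c => t + Q + d (t / Q) c) y ∧ ¬ y / Q < m ∧ accept (y % Q)) ↔
      ∃ f : ℕ → γ, (∀ k < m, f k ∈ l ∧ ok k (f k)) ∧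
        accept (∑ k ∈ Finset.range m, d k (f k)) := by
  simp only [reach_rows_iff l ok d hd]
  constructor
  · rintro ⟨_, _, ⟨g, hg, f, hf, rfl⟩, hlt, ha⟩
    have h := hd g hg f
    rw [Nat.add_comm] at hlt ha
    rw [Nat.add_mul_div_right _ _ (by omega), Nat.div_eq_of_lt h, zero_add] at hlt
    rw [Nat.add_mul_mod_self_right, Nat.mod_eq_of_lt h] at ha
    obtain rfl : g = m := by omega
    exact ⟨f, hf, ha⟩
  · rintro ⟨f, hf, ha⟩
    have h := hd m le_rfl f
    refine ⟨m * Q + ∑ k ∈ Finset.range m, d k (f k), by nlinarith, ⟨m, le_rfl, f, hf, rfl⟩, ?_, ?_⟩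
    · rw [Nat.add_comm, Nat.add_mul_div_right _ _ (by omega), Nat.div_eq_of_lt h]
      omega
    · rwa [Nat.add_comm, Nat.add_mul_mod_self_right, Nat.mod_eq_of_lt h]

end RAM.Search

/-! ### Coding vectors in base `B` -/

namespace FairDivision

section Digits

variable {ι : Type*} [Fintype ι]

/-- The number whose digits in base `B` are given by `x`, in some fixed order. -/
noncomputable def digitCode (B : ℕ) (x : ι → ℕ) : ℕ := ∑ p, x p * B ^ (Fintype.equivFin ι p : ℕ)

theorem digitCode_eq {B : ℕ} (x : ι → ℕ) (hx : ∀ p, x p < B) :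
    digitCode B x = finFunctionFinEquiv (m := B) (n := Fintype.card ι)
      (fun k => ⟨x ((Fintype.equivFin ι).symm k), hx _⟩) := by
  rw [finFunctionFinEquiv_apply, digitCode, ← (Fintype.equivFin ι).symm.sum_comp]
  simp

theorem digitCode_lt {B : ℕ} (x : ι → ℕ) (hx : ∀ p, x p < B) :
    digitCode B x < B ^ Fintype.card ι := by
  rw [digitCode_eq x hx]
  exact Fin.isLt _

theorem digitCode_digit {B : ℕ} (x : ι → ℕ) (hx : ∀ p, x p < B) (p : ι) :
    digitCode B x / B ^ (Fintype.equivFin ι p : ℕ) % B = x p := by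
  rw [digitCode_eq x hx]
  generalize hf : (fun k => (⟨x ((Fintype.equivFin ι).symm k), hx _⟩ : Fin B)) = f
  have h := congrFun (finFunctionFinEquiv.symm_apply_apply f) (Fintype.equivFin ι p)
  have h' := congrArg Fin.val h
  rw [finFunctionFinEquiv_symm_apply_val] at h'
  rw [h', ← hf]
  simp

/-- The code is linear in the vector, whether or not the entries are below `B`; smallness is needed
only to read digits back. -/
theorem sum_digitCode {α : Type*} (s : Finset α) (B : ℕ) (x : α → ι → ℕ) :
    ∑ a ∈ s, digitCode B (x a) = digitCode B fun p => ∑ a ∈ s, x a p := by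
  simp only [digitCode, Finset.sum_mul]
  exact Finset.sum_comm

end Digits

/-! ### Layout and length of the input -/

section Encoding

/-- All blocks have the same length `k`, so peeling off the first one shifts the index by `k`. -/
theorem getD_flatMap_finRange {m k : ℕ} (f : Fin m → List ℕ) (hf : ∀ g, (f g).length = k)
    (l : List ℕ) (g : Fin m) {r : ℕ} (hr : r < k) :
    ((List.finRange m).flatMap f ++ l).getD (k * g + r) 0 = (f g).getD r 0 := by
  induction m with
  | zero => exact g.elim0
  | succ m ih =>
    rw [List.finRange_succ, List.flatMap_cons, List.append_assoc, List.flatMap_map]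
    cases g using Fin.cases with
    | zero =>
      rw [Fin.val_zero, mul_zero, zero_add, List.getD_append _ _ _ _ (by rw [hf]; exact hr)]
    | succ g =>
      rw [List.getD_append_right _ _ _ _ (by rw [hf, Fin.val_succ]; nlinarith), hf]
      rw [← ih (fun g => f g.succ) (fun g => hf _) g]
      congr 1
      rw [Fin.val_succ, mul_add, mul_one]
      omega

theorem length_flatMap_finRange {m k : ℕ} (f : Fin m → List ℕ) (hf : ∀ g, (f g).length = k) :
    ((List.finRange m).flatMap f).length = m * k := by
  simp [List.length_flatMap, hf]

variable {n : ℕ} (F : Notion) (I : Instance n) (w : Fin n → ℚ)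

/-- The memory cells that hold the encoding of an instance. -/
def cell (a : ℕ) : ℕ := (encode F I w).getD a 0

theorem cell_zero : cell F I w 0 = I.m := rfl

theorem length_items :
    ((List.finRange I.m).flatMap fun g =>
      (List.finRange n).flatMap fun i => [I.v i g, I.s i g]).length = I.m * (n * 2) :=
  length_flatMap_finRange _ fun _ => length_flatMap_finRange _ fun _ => rfl

theorem cell_item (g : Fin I.m) (i : Fin n) {r : ℕ} (hr : r < 2) :
    cell F I w (1 + 2 * (n * g + i) + r) = [I.v i g, I.s i g].getD r 0 := by
  have h : 1 + 2 * (n * (g : ℕ) + i) + r = ((n * 2) * g + (2 * i + r)) + 1 := by ring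
  rw [cell, encode, h, List.getD_cons_succ,
    getD_flatMap_finRange (k := n * 2) _ (fun _ => length_flatMap_finRange _ fun _ => rfl) _ _
      (by have := i.isLt; omega)]
  have h' := getD_flatMap_finRange (fun i => [I.v i g, I.s i g]) (fun _ => rfl) [] i hr
  rwa [List.append_nil] at h'

theorem cell_v (g : Fin I.m) (i : Fin n) : cell F I w (1 + 2 * (n * g + i)) = I.v i g :=
  cell_item F I w g i (r := 0) (by omega)

theorem cell_s (g : Fin I.m) (i : Fin n) : cell F I w (2 + 2 * (n * g + i)) = I.s i g := by
  rw [← show 1 + 2 * (n * (g : ℕ) + i) + 1 = 2 + 2 * (n * g + i) by ring]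
  exact cell_item F I w g i (r := 1) (by omega)

theorem cell_weight (hF : F.weighted = true) (i : Fin n) {r : ℕ} (hr : r < 2) :
    cell F I w (1 + 2 * n * I.m + 2 * i + r) = [(w i).num.toNat, (w i).den].getD r 0 := by
  have h : 1 + 2 * n * I.m + 2 * i + r = I.m * (n * 2) + (2 * i + r) + 1 := by ring
  rw [cell, encode, h, List.getD_cons_succ, List.getD_append_right _ _ _ _
    (by rw [length_items]; omega), length_items, if_pos hF]
  have h' := getD_flatMap_finRange (fun i => [(w i).num.toNat, (w i).den]) (fun _ => rfl) [] i hr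
  rw [List.append_nil] at h'
  rw [← h']
  congr 1
  omega

theorem length_encode :
    1 + 2 * n * I.m ≤ (encode F I w).length ∧
      (encode F I w).length ≤ 1 + 2 * n * I.m + 2 * n := by
  rw [encode, List.length_cons, List.length_append, length_items]
  have h : (if F.weighted = true then
      (List.finRange n).flatMap fun i => [(w i).num.toNat, (w i).den] else []).length ≤ n * 2 := by
    split_ifs
    · exact (length_flatMap_finRange (k := 2) _ fun _ => rfl).le
    · simp
  have h' : I.m * (n * 2) = 2 * n * I.m := by ring
  omega

/-- The table starts at this address, which leaves room for weights whether or not they are present;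
it needs no clearing. -/
theorem cell_eq_zero {a : ℕ} (ha : 1 + 2 * n * I.m + 2 * n ≤ a) : cell F I w a = 0 :=
  List.getD_eq_default _ _ ((length_encode F I w).2.trans ha)

theorem size_getD_le (l : List ℕ) (a : ℕ) : (l.getD a 0).size ≤ RAM.inputSize l := by
  by_cases h : a < l.length
  · rw [List.getD_eq_getElem _ _ h]
    have h1 : 1 + (l[a]).size ∈ l.map fun x => 1 + Nat.size x :=
      List.mem_map.2 ⟨_, List.getElem_mem h, rfl⟩
    have := List.single_le_sum (fun _ _ => Nat.zero_le _) _ h1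
    rw [RAM.inputSize]
    omega
  · rw [List.getD_eq_default _ _ (by omega)]
    simp

theorem length_le_inputSize (l : List ℕ) : l.length ≤ RAM.inputSize l := by
  induction l with
  | nil => simp
  | cons a l ih =>
    simp only [RAM.inputSize, List.map_cons, List.sum_cons, List.length_cons] at ih ⊢
    omega

theorem items_le_inputSize : n * I.m ≤ RAM.inputSize (encode F I w) := by
  have h1 := (length_encode F I w).1
  have h2 := length_le_inputSize (encode F I w)
  nlinarith

theorem Instance.v_le_maxValue (i : Fin n) (g : Fin I.m) : I.v i g ≤ I.maxValue :=
  (Finset.le_sup (f := fun g => I.v i g) (Finset.mem_univ g)).trans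
    (Finset.le_sup (f := fun i => Finset.univ.sup fun g => I.v i g) (Finset.mem_univ i))

end Encoding

end FairDivision

/-! ### The dynamic program in machine expressions -/

namespace FairDivision

open RAM

/-- The positions of the digits of the dynamic program. -/
abbrev Digit (n : ℕ) := Fin n × Fin n × Fin 3

namespace Program

variable (n : ℕ) (F : Notion)

/-- The number of items. -/
def items : Expr := .mem (0 : ℕ)

/-- The first memory cell of the table. -/
def base : Expr := (1 : ℕ) + (2 * n : ℕ) * items + (2 * n : ℕ)

/-- The length of a row of the table. -/
def width : Expr := Expr.acc.pow (Fintype.card (Digit n))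

/-- The number of cells of the table. -/
def total : Expr := (items + (1 : ℕ)) * width n

/-- The current position in the table. -/
def pos : Expr := total n - .cnt

/-- The current row. -/
def row : Expr := pos n / width n

/-- The current position in the current row. -/
def code : Expr := pos n - row n * width n

variable {n}

/-- The value of the current item for an agent. -/
def value (i : Fin n) : Expr :=
  .mem ((1 : ℕ) + (2 : ℕ) * ((n : ℕ) * row n + (i : ℕ)))

/-- The social impact of the current item for an agent. -/
def impact (i : Fin n) : Expr :=
  .mem ((2 : ℕ) + (2 : ℕ) * ((n : ℕ) * row n + (i : ℕ)))

open Classical in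
/-- A test whether a move is allowed for the current item. -/
noncomputable def allowed (c : Instance.Move n) : Expr :=
  Expr.prod (fun i : Fin n => (impact i).le (impact c.1)) *
    ((if F.strong = true → c.2 = ∅ ∨ c.2 = Finset.univ then 1 else 0 : ℕ) : Expr)

/-- The contribution of a move to a digit. -/
def gain (c : Instance.Move n) : Digit n → Expr
  | (i, j, 0) => if j = c.1 then value i else (0 : ℕ)
  | (i, j, 1) => if j = c.1 ∧ i ∈ c.2 then (1 : ℕ) else (0 : ℕ)
  | (i, j, 2) => if j = c.1 ∧ i ∈ c.2 then value i else (0 : ℕ)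

/-- The table cell to which a move leads. -/
noncomputable def target (c : Instance.Move n) : Expr :=
  base n + (pos n + width n + Expr.sum fun p => gain c p * Expr.acc.pow (Fintype.equivFin _ p))

/-- A digit of the current position in the current row. -/
noncomputable def digit (p : Digit n) : Expr :=
  code n / Expr.acc.pow (Fintype.equivFin _ p) -
    code n / Expr.acc.pow (Fintype.equivFin _ p) / .acc * .acc

/-- The numerator of the weight of an agent. -/
def num (i : Fin n) : Expr :=
  if F.weighted then .mem ((1 : ℕ) + (2 * n : ℕ) * items + (2 * (i : ℕ) : ℕ)) else (1 : ℕ)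

/-- The denominator of the weight of an agent. -/
def den (i : Fin n) : Expr :=
  if F.weighted then .mem ((1 : ℕ) + (2 * n : ℕ) * items + (2 * (i : ℕ) : ℕ) + (1 : ℕ))
  else (1 : ℕ)

/-- A test for the condition that the fairness notion puts on two agents. -/
def localTest (m p q p' q' own other card wit : Expr) : Expr :=
  match F with
  | .EF => other.le own
  | .EFL => (other - wit).le (0 : ℕ) +
      Expr.le (1 : ℕ) card * ((other - wit).le own * wit.le own)
  | .tEF1 => other.le own + Expr.le (1 : ℕ) card * (other - wit).le (own + wit)
  | .EF1 | .sEF1 | .wEF1 | .swEF1 =>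
    Expr.le (1 : ℕ) m * ((other - wit) * (q' * p)).le (own * (q * p'))

theorem eval_localTest_ne_zero (E : Env) (m p q p' q' own other card wit : Expr) :
    (localTest F m p q p' q' own other card wit).eval E ≠ 0 ↔
      F.Local (m.eval E) (p.eval E) (q.eval E) (p'.eval E) (q'.eval E) (own.eval E)
        (other.eval E) (card.eval E) (wit.eval E) := by
  cases F <;>
    simp only [localTest, Notion.Local, Expr.eval_add_ne_zero, Expr.eval_mul_ne_zero,
      Expr.eval_le_ne_zero] <;>
    rfl

/-- A test for acceptance. -/
noncomputable def accept : Expr :=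
  Expr.prod fun i : Fin n => Expr.prod fun j : Fin n => (digit (i, j, 1)).le (1 : ℕ) *
    localTest F items (num F i) (den F i) (num F j) (den F j) (digit (i, i, 0)) (digit (i, j, 0))
      (digit (i, j, 1)) (digit (i, j, 2))

/-- The search for an allocation. -/
noncomputable def search (n : ℕ) (F : Notion) : Search (Instance.Move n) where
  moves := Finset.univ.toList
  addr := base n + pos n
  live := items - row n
  accept := accept (n := n) F
  allowed := allowed F
  target := target

end Program

variable {n : ℕ} (F : Notion) (I : Instance n) (w : Fin n → ℚ)

/-- A bound for the digits of the dynamic program. -/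
def digitBound : ℕ :=
  1 + I.m + ∑ k ∈ Finset.range (n * I.m), cell F I w (1 + 2 * k)

/-- The value that agent `i` has for item number `k`, as it stands in the memory. -/
def cellValue (k : ℕ) (i : Fin n) : ℕ := cell F I w (1 + 2 * (n * k + i))

/-- `Allowed`, in terms of the memory. -/
def CellAllowed (k : ℕ) (c : Instance.Move n) : Prop :=
  (∀ i : Fin n, cell F I w (2 + 2 * (n * k + i)) ≤ cell F I w (2 + 2 * (n * k + c.1))) ∧
    (F.strong = true → c.2 = ∅ ∨ c.2 = Finset.univ)

/-- The contribution of a move to the position in a row. -/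
noncomputable def contribution (k : ℕ) (c : Instance.Move n) : ℕ :=
  digitCode (digitBound F I w) (Instance.gain (cellValue F I w k) c)

/-- The length of a row of the table. -/
noncomputable def rowLength : ℕ := digitBound F I w ^ Fintype.card (Digit n)

theorem rowLength_pos : 0 < rowLength F I w :=
  Nat.pow_pos (by unfold digitBound; omega)

theorem sum_cells_eq :
    ∑ k ∈ Finset.range (n * I.m), cell F I w (1 + 2 * k) = ∑ g : Fin I.m, ∑ i, I.v i g := by
  have h (m : ℕ) : ∑ k ∈ Finset.range (n * m), cell F I w (1 + 2 * k) =
      ∑ k ∈ Finset.range m, ∑ i, cellValue F I w k i := by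
    induction m with
    | zero => simp
    | succ m ih =>
      rw [mul_add, mul_one, Finset.sum_range_add, ih, Finset.sum_range_succ,
        Finset.sum_range fun x => cell F I w (1 + 2 * (n * m + x))]
      rfl
  rw [h, Finset.sum_range]
  exact Finset.sum_congr rfl fun g _ => Finset.sum_congr rfl fun i _ => cell_v F I w g i

/-- Here the largest value enters the running time, which makes it pseudo-polynomial. -/
theorem digitBound_le : digitBound F I w ≤ 1 + I.m + n * I.m * I.maxValue := by
  rw [digitBound, sum_cells_eq]
  have h : ∑ g : Fin I.m, ∑ i, I.v i g ≤ ∑ _g : Fin I.m, ∑ _i : Fin n, I.maxValue :=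
    Finset.sum_le_sum fun g _ => Finset.sum_le_sum fun i _ => I.v_le_maxValue i g
  simp only [Finset.sum_const, Finset.card_univ, Fintype.card_fin, smul_eq_mul] at h
  have h' : n * I.m * I.maxValue = I.m * (n * I.maxValue) := by ring
  omega

theorem Instance.gain_le (v : Fin n → ℕ) (c : Move n) (p : Digit n) :
    gain v c p ≤ 1 + ∑ i, v i := by
  have h : v p.1 ≤ ∑ i, v i := Finset.single_le_sum (fun _ _ => Nat.zero_le _) (Finset.mem_univ _)
  match p with
  | (i, j, 0) | (i, j, 1) | (i, j, 2) =>
    simp only [gain] at h ⊢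
    split_ifs <;> omega

/-- Each item adds to a digit at most one plus its total value over all agents, and `digitBound` is
one more than the sum of these bounds. This excludes carries. -/
theorem sum_gain_lt {g : ℕ} (hg : g ≤ I.m) (f : ℕ → Instance.Move n) (p : Digit n) :
    ∑ k ∈ Finset.range g, Instance.gain (cellValue F I w k) (f k) p < digitBound F I w := by
  calc ∑ k ∈ Finset.range g, Instance.gain (cellValue F I w k) (f k) p
      ≤ ∑ k ∈ Finset.range g, (1 + ∑ i, cellValue F I w k i) :=
        Finset.sum_le_sum fun k _ => Instance.gain_le _ _ _
    _ ≤ ∑ k ∈ Finset.range I.m, (1 + ∑ i, cellValue F I w k i) :=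
        Finset.sum_le_sum_of_subset (Finset.range_subset_range.2 hg)
    _ = I.m + ∑ k ∈ Finset.range I.m, ∑ i, cellValue F I w k i := by
        rw [Finset.sum_add_distrib]; simp
    _ = I.m + ∑ g : Fin I.m, ∑ i, I.v i g := by
        rw [Finset.sum_range]
        simp only [cellValue, cell_v]
    _ < _ := by rw [digitBound, sum_cells_eq]; omega

theorem sum_contribution (g : ℕ) (f : ℕ → Instance.Move n) :
    ∑ k ∈ Finset.range g, contribution F I w k (f k) = digitCode (digitBound F I w)
      (fun p => ∑ k ∈ Finset.range g, Instance.gain (cellValue F I w k) (f k) p) :=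
  sum_digitCode _ _ _

theorem sum_contribution_lt {g : ℕ} (hg : g ≤ I.m) (f : ℕ → Instance.Move n) :
    ∑ k ∈ Finset.range g, contribution F I w k (f k) < rowLength F I w := by
  rw [sum_contribution]
  exact digitCode_lt _ (sum_gain_lt F I w hg f)

/-- Acceptance of a position in the last row. -/
def AcceptsCode (y : ℕ) : Prop :=
  Instance.Accepts F I.m (F.num w) (F.den w)
    fun p => y / digitBound F I w ^ (Fintype.equivFin (Digit n) p : ℕ) % digitBound F I w

theorem exists_accepted_iff_exists_isSIM_isFair [NeZero n] (hw : ∀ i, 0 < w i) :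
    (∃ y < (I.m + 1) * rowLength F I w,
      Search.Reach Finset.univ.toList (fun t => t / rowLength F I w < I.m)
        (fun t => CellAllowed F I w (t / rowLength F I w))
        (fun t c => t + rowLength F I w + contribution F I w (t / rowLength F I w) c) y ∧
      ¬ y / rowLength F I w < I.m ∧ AcceptsCode F I w (y % rowLength F I w)) ↔
    ∃ A : Fin n → Finset (Fin I.m), I.IsSIM A ∧ I.IsFair w F A := by
  rw [Search.exists_accepted_iff _ (CellAllowed F I w) (contribution F I w)
    (fun g hg f => sum_contribution_lt F I w hg f), Instance.exists_isSIM_isFair_iff hw F]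
  have hallowed (g : Fin I.m) (c : Instance.Move n) :
      CellAllowed F I w g c ↔ Instance.Allowed F I g c := by
    simp only [CellAllowed, cell_s, Instance.Allowed]
  have haccepts (f : ℕ → Instance.Move n) :
      AcceptsCode F I w (∑ k ∈ Finset.range I.m, contribution F I w k (f k)) ↔
        Instance.Accepts F I.m (F.num w) (F.den w)
          (fun p => ∑ g : Fin I.m, Instance.gain (I.v · g) (f g) p) := by
    rw [AcceptsCode, sum_contribution]
    simp only [digitCode_digit _ (sum_gain_lt F I w le_rfl f)]
    have hv (g : Fin I.m) : cellValue F I w g = (I.v · g) := funext fun i => cell_v F I w g i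
    simp only [Finset.sum_range, hv]
  simp only [Finset.mem_toList, Finset.mem_univ, true_and, haccepts]
  constructor
  · rintro ⟨f, hf, h⟩
    exact ⟨fun g => f g, fun g => (hallowed g _).1 (hf g g.isLt), h⟩
  · rintro ⟨f, hf, h⟩
    -- The default beyond the last item is never used, but naming it needs an agent `0`.
    refine ⟨fun k => if hk : k < I.m then f ⟨k, hk⟩ else (0, ∅), fun k hk => ?_, ?_⟩
    · simp only [hk, dif_pos]
      exact (hallowed ⟨k, hk⟩ _).2 (hf _)
    · simpa using h

-- The expressions read input cells only below the table, where memory is unchanged. In the tests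
-- and targets of moves, `live` guarantees that the current row is the index of an item.
open Classical in
theorem search_spec :
    (Program.search n F).Spec (digitBound F I w) ((I.m + 1) * rowLength F I w)
      (1 + 2 * n * I.m + 2 * n) (cell F I w)
      (fun t => t / rowLength F I w < I.m)
      (fun t => AcceptsCode F I w (t % rowLength F I w))
      (fun t => CellAllowed F I w (t / rowLength F I w))
      (fun t c => t + rowLength F I w + contribution F I w (t / rowLength F I w) c) := by
  have hitems {t : ℕ} {E : Env} (hE : E.At (digitBound F I w) ((I.m + 1) * rowLength F I w)
      (1 + 2 * n * I.m + 2 * n) (cell F I w) t) : Program.items.eval E = I.m := by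
    simp only [Program.items, Expr.eval_mem, Expr.eval_natCast]
    rw [hE.mem 0 (by omega), cell_zero]
  have hbase {t : ℕ} {E : Env} (hE : E.At (digitBound F I w) ((I.m + 1) * rowLength F I w)
      (1 + 2 * n * I.m + 2 * n) (cell F I w) t) :
      (Program.base n).eval E = 1 + 2 * n * I.m + 2 * n := by
    simp only [Program.base, Expr.eval_add, Expr.eval_mul, Expr.eval_natCast, hitems hE]
  have hwidth {t : ℕ} {E : Env} (hE : E.At (digitBound F I w) ((I.m + 1) * rowLength F I w)
      (1 + 2 * n * I.m + 2 * n) (cell F I w) t) :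
      (Program.width n).eval E = rowLength F I w := by
    simp only [Program.width, Expr.eval_pow, Expr.eval_acc, hE.acc, rowLength]
  have hpos {t : ℕ} (ht : t < (I.m + 1) * rowLength F I w) {E : Env}
      (hE : E.At (digitBound F I w) ((I.m + 1) * rowLength F I w)
      (1 + 2 * n * I.m + 2 * n) (cell F I w) t) :
      (Program.pos n).eval E = t := by
    simp only [Program.pos, Program.total, Expr.eval_add, Expr.eval_mul, Expr.eval_sub,
      Expr.eval_natCast, Expr.eval_cnt, hitems hE, hwidth hE, hE.cnt]
    omega
  have hrow {t : ℕ} (ht : t < (I.m + 1) * rowLength F I w) {E : Env}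
      (hE : E.At (digitBound F I w) ((I.m + 1) * rowLength F I w)
      (1 + 2 * n * I.m + 2 * n) (cell F I w) t) :
      (Program.row n).eval E = t / rowLength F I w := by
    simp only [Program.row, Expr.eval_div, hpos ht hE, hwidth hE]
  have hcode {t : ℕ} (ht : t < (I.m + 1) * rowLength F I w) {E : Env}
      (hE : E.At (digitBound F I w) ((I.m + 1) * rowLength F I w)
      (1 + 2 * n * I.m + 2 * n) (cell F I w) t) :
      (Program.code n).eval E = t % rowLength F I w := by
    simp only [Program.code, Expr.eval_sub, Expr.eval_mul, hpos ht hE, hwidth hE, hrow ht hE]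
    exact Nat.mod_eq_sub_div_mul.symm
  have hcell {k : ℕ} (hk : k < I.m) (i : Fin n) :
      2 + 2 * (n * k + i) < 1 + 2 * n * I.m + 2 * n := by
    have h1 : n * k ≤ n * I.m := Nat.mul_le_mul_left _ hk.le
    have h2 : 2 * n * I.m = 2 * (n * I.m) := by ring
    have h3 := i.isLt
    omega
  refine ⟨fun t ht E hE => ?_, fun t ht E hE => ?_, fun t ht E hE hl => ?_,
    fun t ht E hE hl c => ?_, fun t ht E hE hl c => ?_, fun t c => ?_⟩
  · simp only [Program.search, Expr.eval_add, hbase hE, hpos ht hE]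
  · simp only [Program.search, Expr.eval_sub, hitems hE, hrow ht hE]
    omega
  · have hdigit (p : Digit n) : (Program.digit p).eval E = t % rowLength F I w /
        digitBound F I w ^ (Fintype.equivFin (Digit n) p : ℕ) % digitBound F I w := by
      simp only [Program.digit, Expr.eval_sub, Expr.eval_mul, Expr.eval_div, Expr.eval_pow,
        Expr.eval_acc, hcode ht hE, hE.acc]
      exact Nat.mod_eq_sub_div_mul.symm
    have hcell' (i : Fin n) {r : ℕ} (hr : r < 2) : F.weighted = true →
        E.mem (1 + 2 * n * I.m + 2 * i + r) = [(w i).num.toNat, (w i).den].getD r 0 := by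
      intro hF
      rw [hE.mem _ (by have := i.isLt; omega), cell_weight F I w hF i hr]
    have hnum (i : Fin n) : (Program.num F i).eval E = F.num w i := by
      unfold Program.num Notion.num
      split_ifs with hF
      · simp only [Expr.eval_mem, Expr.eval_add, Expr.eval_mul, Expr.eval_natCast, hitems hE]
        exact hcell' i (r := 0) (by omega) hF
      · rfl
    have hden (i : Fin n) : (Program.den F i).eval E = F.den w i := by
      unfold Program.den Notion.den
      split_ifs with hF
      · simp only [Expr.eval_mem, Expr.eval_add, Expr.eval_mul, Expr.eval_natCast, hitems hE]
        exact hcell' i (r := 1) (by omega) hF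
      · rfl
    simp only [Program.search, Program.accept, Expr.eval_prod_ne_zero, Expr.eval_mul_ne_zero,
      Expr.eval_le_ne_zero, Program.eval_localTest_ne_zero, hdigit, hnum, hden, hitems hE,
      Expr.eval_natCast, AcceptsCode, Instance.Accepts]
  · have himpact (i : Fin n) : (Program.impact i).eval E =
        cell F I w (2 + 2 * (n * (t / rowLength F I w) + i)) := by
      simp only [Program.impact, Expr.eval_mem, Expr.eval_add, Expr.eval_mul, Expr.eval_natCast,
        hrow ht hE]
      exact hE.mem _ (hcell hl i)
    simp only [Program.search, Program.allowed, Expr.eval_mul_ne_zero, Expr.eval_prod_ne_zero,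
      Expr.eval_le_ne_zero, himpact, Expr.eval_natCast, CellAllowed]
    refine and_congr_right fun _ => ?_
    split_ifs with h
    · exact iff_of_true one_ne_zero h
    · exact iff_of_false (fun h' => h' rfl) h
  · have hvalue (i : Fin n) : (Program.value i).eval E =
        cellValue F I w (t / rowLength F I w) i := by
      simp only [Program.value, Expr.eval_mem, Expr.eval_add, Expr.eval_mul, Expr.eval_natCast,
        hrow ht hE]
      exact hE.mem _ ((Nat.add_lt_add_right (by omega) _).trans (hcell hl i))
    have hgain (p : Digit n) : (Program.gain c p).eval E =
        Instance.gain (cellValue F I w (t / rowLength F I w)) c p := by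
      match p with
      | (i, j, 0) | (i, j, 1) | (i, j, 2) =>
        simp only [Program.gain, Instance.gain]
        split_ifs
        · first | exact hvalue i | rfl
        · rfl
    simp only [Program.search, Program.target, Expr.eval_add, Expr.eval_sum, Expr.eval_mul,
      Expr.eval_pow, Expr.eval_acc, hbase hE, hpos ht hE, hwidth hE, hgain, hE.acc, contribution,
      digitCode]
  · have := rowLength_pos F I w
    omega

end FairDivision

/-! ### The whole algorithm and its cost -/

namespace FairDivision

open RAM

namespace Program

/-- The loop body that adds up the values of all items for all agents. -/
def addValueProg : Prog :=
  .seq (.setAcc (.acc + .mem ((2 : ℕ) * .cnt - (1 : ℕ)))) (.setCnt (.cnt - (1 : ℕ)))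

/-- The effect of `addValueProg`. -/
def addValue (E : Env) : Env :=
  { E with acc := E.acc + E.mem (2 * E.cnt - 1), cnt := E.cnt - 1 }

theorem implements_addValueProg : Implements addValueProg addValue :=
  (implements_setAcc _).seq (implements_setCnt _)

/-- The loop counts down, so `t` rounds add the last `t` values. The offset `c` also describes
unfinished loops, whose states must be shown to be small. -/
theorem iterate_addValue (M : ℕ → ℕ) (a r c t : ℕ) :
    addValue^[t] ⟨a, r, c + t, M⟩ =
      ⟨a, r + ∑ k ∈ Finset.range t, M (1 + 2 * (c + k)), c, M⟩ := by
  induction t generalizing r with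
  | zero => simp
  | succ t ih =>
    have h : addValue ⟨a, r, c + (t + 1), M⟩ = ⟨a, r + M (1 + 2 * (c + t)), c + t, M⟩ := by
      rw [addValue, Env.mk.injEq]
      refine ⟨rfl, ?_, by dsimp only; omega, rfl⟩
      dsimp only
      congr 2
      omega
    rw [Function.iterate_succ_apply, h, ih, Finset.sum_range_succ, Env.mk.injEq]
    refine ⟨rfl, ?_, rfl, rfl⟩
    ring

/-- Preparation of the loop that adds up the values. -/
def beforeSum (n : ℕ) : Prog :=
  .seq (.setAcc ((1 : ℕ) + items)) (.setCnt ((n : ℕ) * items))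

theorem implements_beforeSum (n : ℕ) : Implements (beforeSum n) fun E =>
    ⟨E.ans, 1 + E.mem 0, n * E.mem 0, E.mem⟩ :=
  (implements_setAcc _).seq (implements_setCnt _)

/-- Preparation of the search. -/
def beforeSearch (n : ℕ) : Prog :=
  .seq (.write (base n) (1 : ℕ)) (.setCnt (total n))

/-- Mark the first cell of the table. -/
def markBase (n : ℕ) (E : Env) : Env :=
  { E with mem := Function.update E.mem ((base n).eval E) 1 }

theorem implements_beforeSearch (n : ℕ) : Implements (beforeSearch n) fun E =>
    { markBase n E with cnt := (total n).eval (markBase n E) } :=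
  (implements_write _ _).seq (implements_setCnt _)

/-- The algorithm for a positive number of agents. -/
noncomputable def main (n : ℕ) (F : Notion) : Prog :=
  .seq (beforeSum n) (.seq (.loop 2 addValueProg)
    (.seq (beforeSearch n) (.loop 2 (search n F).stepProg)))

end Program

variable {n : ℕ} (F : Notion) (I : Instance n) (w : Fin n → ℚ)

/-- A bound for all numbers other than those of the input. -/
noncomputable def numberBound : ℕ :=
  inputSize (encode F I w) + digitBound F I w + (I.m + 1) * rowLength F I w

/-- The visible part of the state at the start. -/
def startEnv : Env := ⟨0, 0, 0, cell F I w⟩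

/-- The visible part of the state when the values are to be added up. -/
def sumEnv : Env := ⟨0, 1 + I.m, n * I.m, cell F I w⟩

/-- The visible part of the state when the values have been added up. -/
def boundEnv : Env := ⟨0, digitBound F I w, 0, cell F I w⟩

/-- The visible part of the state when the search starts. -/
noncomputable def searchEnv : Env :=
  ⟨0, digitBound F I w, (I.m + 1) * rowLength F I w,
    Function.update (cell F I w) (1 + 2 * n * I.m + 2 * n) 1⟩

theorem size_le_of_le {a z : ℕ} (h : a ≤ z) : a.size ≤ z := (size_le_self a).trans h

theorem one_le_numberBound : 1 ≤ numberBound F I w := by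
  have : 1 ≤ digitBound F I w := by unfold digitBound; omega
  unfold numberBound
  omega

theorem size_cell_le (a : ℕ) : (cell F I w a).size ≤ numberBound F I w :=
  (size_getD_le _ a).trans (by unfold numberBound; omega)

theorem startEnv_small : (startEnv F I w).Small (numberBound F I w) :=
  ⟨size_le_of_le (Nat.zero_le _), size_le_of_le (Nat.zero_le _), size_cell_le F I w⟩

theorem boundEnv_small : (boundEnv F I w).Small (numberBound F I w) :=
  ⟨size_le_of_le (by unfold numberBound boundEnv; dsimp only; omega),
    size_le_of_le (Nat.zero_le _), size_cell_le F I w⟩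

theorem searchEnv_small : (searchEnv F I w).Small (numberBound F I w) := by
  refine ⟨size_le_of_le (by unfold numberBound searchEnv; dsimp only; omega),
    size_le_of_le (by unfold numberBound searchEnv; dsimp only; omega), fun a => ?_⟩
  dsimp only [searchEnv]
  rw [Function.update_apply]
  split_ifs
  · exact size_le_of_le (one_le_numberBound F I w)
  · exact size_cell_le F I w a

theorem iterate_sumEnv {t : ℕ} (ht : t ≤ n * I.m) :
    Program.addValue^[t] (sumEnv F I w) =
      ⟨0, 1 + I.m + ∑ k ∈ Finset.range t, cell F I w (1 + 2 * (n * I.m - t + k)), n * I.m - t,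
        cell F I w⟩ := by
  have h := Program.iterate_addValue (cell F I w) 0 (1 + I.m) (n * I.m - t) t
  rwa [Nat.sub_add_cancel ht] at h

theorem iterate_sumEnv_acc_le {t : ℕ} (ht : t ≤ n * I.m) :
    (Program.addValue^[t] (sumEnv F I w)).acc ≤ digitBound F I w := by
  rw [iterate_sumEnv F I w ht, digitBound]
  have h := Finset.sum_range_add (fun k => cell F I w (1 + 2 * k)) (n * I.m - t) t
  rw [Nat.sub_add_cancel ht] at h
  dsimp only
  omega

theorem iterate_sumEnv_small {t : ℕ} (ht : t ≤ n * I.m) :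
    (Program.addValue^[t] (sumEnv F I w)).Small (numberBound F I w) ∧
      (Program.addValue^[t] (sumEnv F I w)).cnt = n * I.m - t := by
  have h := iterate_sumEnv_acc_le F I w ht
  have h' := items_le_inputSize F I w
  refine ⟨⟨size_le_of_le (h.trans (by unfold numberBound; omega)), ?_, fun a => ?_⟩, ?_⟩ <;>
    rw [iterate_sumEnv F I w ht]
  · exact size_le_of_le (by unfold numberBound; dsimp only; omega)
  · exact size_cell_le F I w a

theorem iterate_sumEnv_end :
    Program.addValue^[(sumEnv F I w).cnt] (sumEnv F I w) = boundEnv F I w := by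
  have hc : (sumEnv F I w).cnt = n * I.m := rfl
  rw [hc, iterate_sumEnv F I w le_rfl]
  simp only [boundEnv, Nat.sub_self, zero_add, digitBound]

theorem searchEnv_at : (searchEnv F I w).At (digitBound F I w) ((I.m + 1) * rowLength F I w)
    (1 + 2 * n * I.m + 2 * n) (cell F I w) 0 :=
  ⟨rfl, rfl, fun _ hx => Function.update_of_ne hx.ne _ _⟩

theorem searchEnv_marks (x : ℕ) :
    (searchEnv F I w).mem (1 + 2 * n * I.m + 2 * n + x) ≠ 0 ↔ x = 0 := by
  dsimp only [searchEnv]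
  rw [Function.update_apply, cell_eq_zero F I w (by omega)]
  simp

theorem iterate_searchEnv_small {t : ℕ} (ht : t ≤ (I.m + 1) * rowLength F I w) :
    ((Program.search n F).step^[t] (searchEnv F I w)).Small (numberBound F I w) ∧
      ((Program.search n F).step^[t] (searchEnv F I w)).cnt = (I.m + 1) * rowLength F I w - t := by
  refine ⟨?_, ((search_spec F I w).iterate_spec (searchEnv_at F I w) rfl (searchEnv_marks F I w)
    ht).1.cnt⟩
  clear ht
  induction t with
  | zero => exact searchEnv_small F I w
  | succ t ih =>
    rw [Function.iterate_succ_apply']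
    exact Search.step_small (one_le_numberBound F I w) ih

open Classical in
theorem iterate_searchEnv_ans [NeZero n] (hw : ∀ i, 0 < w i) :
    ((Program.search n F).step^[(searchEnv F I w).cnt] (searchEnv F I w)).ans =
      if ∃ A : Fin n → Finset (Fin I.m), I.IsSIM A ∧ I.IsFair w F A then 1 else 0 := by
  have h := ((search_spec F I w).iterate_spec (searchEnv_at F I w) rfl (searchEnv_marks F I w)
    le_rfl).2.1
  have h' := exists_accepted_iff_exists_isSIM_isFair F I w hw
  split_ifs with hA
  · exact h.trans (if_pos (h'.2 hA))
  · exact h.trans (if_neg fun hy => hA (h'.1 hy))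

theorem exists_runs_main (n : ℕ) (F : Notion) :
    ∃ K, ∀ (I : Instance n) (w : Fin n → ℚ), Runs (Program.main n F) (startEnv F I w)
      (K * (numberBound F I w + 1) ^ 3)
      ((Program.search n F).step^[(searchEnv F I w).cnt] (searchEnv F I w)) := by
  obtain ⟨K₁, h₁⟩ := Program.implements_beforeSum n
  obtain ⟨K₂, h₂⟩ := Program.implements_addValueProg.exists_runs_loop
  obtain ⟨K₃, h₃⟩ := Program.implements_beforeSearch n
  obtain ⟨K₄, h₄⟩ := (Program.search n F).implements_stepProg.exists_runs_loop
  refine ⟨K₁ + K₂ + K₃ + K₄, fun I w => ?_⟩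
  have hr₁ : Runs _ (startEnv F I w) _ (sumEnv F I w) := (h₁ _ _ (startEnv_small F I w)).2
  have hr₂ := h₂ _ (sumEnv F I w) fun i hi => iterate_sumEnv_small F I w hi
  rw [iterate_sumEnv_end] at hr₂
  have hr₃ := (h₃ _ _ (boundEnv_small F I w)).2
  have henv : ({ Program.markBase n (boundEnv F I w) with
      cnt := (Program.total n).eval (Program.markBase n (boundEnv F I w)) } : Env) =
      searchEnv F I w := by
    -- The table starts above cell `0`, so the number of items is still readable after the first
    -- mark.
    have hmem : (Program.markBase n (boundEnv F I w)).mem 0 = I.m :=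
      Function.update_of_ne (by
        simp only [Program.base, Expr.eval_add, Expr.eval_natCast]
        omega) _ _
    simp only [Program.total, Program.items, Program.width, Expr.eval_add, Expr.eval_mul,
      Expr.eval_pow, Expr.eval_mem, Expr.eval_natCast, Expr.eval_acc, hmem]
    rfl
  dsimp only at hr₃
  rw [henv] at hr₃
  have hr₄ := h₄ _ (searchEnv F I w) fun i hi => iterate_searchEnv_small F I w hi
  refine (hr₁.seq (hr₂.seq (hr₃.seq hr₄))).mono ?_
  set z := numberBound F I w with hz
  have hc₂ : (sumEnv F I w).cnt ≤ z := (items_le_inputSize F I w).trans (by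
    rw [hz]; unfold numberBound; omega)
  have hc₄ : (searchEnv F I w).cnt ≤ z := by
    rw [hz]; unfold numberBound searchEnv; dsimp only; omega
  have h1 : 1 ≤ z + 1 := by omega
  -- Both loops make at most `z` rounds of quadratic cost; the straight-line parts are padded to the
  -- same cubic form.
  calc _ ≤ K₁ * (z + 1) ^ 2 * (z + 1) + (K₂ * (z + 1) * (z + 1) ^ 2 +
        (K₃ * (z + 1) ^ 2 * (z + 1) + K₄ * (z + 1) * (z + 1) ^ 2)) := by
        refine Nat.add_le_add (Nat.le_mul_of_pos_right _ h1) (Nat.add_le_add ?_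
          (Nat.add_le_add (Nat.le_mul_of_pos_right _ h1) ?_)) <;> gcongr
    _ = _ := by ring

/-- A bound for `numberBound` in terms of the size of the input and the largest value. -/
noncomputable def numberPoly (n : ℕ) : Polynomial ℕ :=
  .X + (1 + .X + .X ^ 2) + (.X + 1) * (1 + .X + .X ^ 2) ^ Fintype.card (Digit n)

/-- With at least one agent, `I.m ≤ n * I.m`, and the latter is bounded by the input length; the
exponent in the row length depends on `n` only. -/
theorem numberBound_le [NeZero n] :
    numberBound F I w ≤ (numberPoly n).eval (inputSize (encode F I w) + I.maxValue) := by
  set X := inputSize (encode F I w) + I.maxValue with hX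
  have hnm : n * I.m ≤ X := (items_le_inputSize F I w).trans (Nat.le_add_right _ _)
  have hm : I.m ≤ X := (Nat.le_mul_of_pos_left _ (NeZero.pos n)).trans hnm
  have hB : digitBound F I w ≤ 1 + X + X ^ 2 := by
    refine (digitBound_le F I w).trans ?_
    rw [sq]
    gcongr
    exact Nat.le_add_left _ _
  simp only [numberPoly, Polynomial.eval_add, Polynomial.eval_mul, Polynomial.eval_pow,
    Polynomial.eval_X, Polynomial.eval_one]
  unfold numberBound rowLength
  gcongr
  exact Nat.le_add_right _ _

theorem env_init_encode : (State.init (encode F I w)).env = startEnv F I w := rfl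

/-- The algorithm for no agents: there is an allocation if and only if there is no item. -/
def noAgentsProg : Prog := .cond Program.items (.const 0 0) (.const 0 1)

theorem implements_noAgentsProg : Implements noAgentsProg fun E =>
    if E.mem 0 ≠ 0 then { E with ans := 0 } else { E with ans := 1 } :=
  Implements.cond _ (implements_setAns 0) (implements_setAns 1)

theorem exists_isSIM_isFair_iff_of_no_agents (I : Instance 0) (w : Fin 0 → ℚ) :
    (∃ A, I.IsSIM A ∧ I.IsFair w F A) ↔ I.m = 0 := by
  constructor
  · rintro ⟨A, hA, -⟩
    by_contra h
    exact (hA.1.2 ⟨0, Nat.pos_of_ne_zero h⟩).choose.elim0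
  · intro h
    have hm (g : Fin I.m) : False := by have := g.isLt; omega
    refine ⟨nofun, ⟨⟨nofun, fun g => (hm g).elim⟩, fun A' _ => by simp [Instance.SI]⟩, ?_⟩
    cases F <;> exact nofun

theorem exists_decides_no_agents (F : Notion) : ∃ (P : Prog) (p : Polynomial ℕ),
    ∀ (I : Instance 0) (w : Fin 0 → ℚ), DecidesWithin P (encode F I w)
      (∃ A : Fin 0 → Finset (Fin I.m), I.IsSIM A ∧ I.IsFair w F A)
      (p.eval (inputSize (encode F I w) + I.maxValue)) := by
  obtain ⟨K, hK⟩ := implements_noAgentsProg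
  refine ⟨noAgentsProg, .C K * (.X + 1) ^ 2, fun I w => ?_⟩
  have hs : (startEnv F I w).Small (inputSize (encode F I w)) :=
    ⟨size_le_of_le (Nat.zero_le _), size_le_of_le (Nat.zero_le _), size_getD_le _⟩
  obtain ⟨t, τ, hx, ht, hτ⟩ := (hK _ _ hs).2 _ (env_init_encode F I w)
  refine ⟨t, τ, hx, ht.trans ?_, ?_⟩
  · simp only [Polynomial.eval_add, Polynomial.eval_mul, Polynomial.eval_pow, Polynomial.eval_X,
      Polynomial.eval_one, Polynomial.eval_C]
    gcongr
    exact Nat.le_add_right _ _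
  · rw [exists_isSIM_isFair_iff_of_no_agents]
    have hans : τ.reg 0 = τ.env.ans := rfl
    have hmem : (startEnv F I w).mem 0 = I.m := rfl
    rw [hans, hτ]
    dsimp only
    rw [hmem]
    by_cases h : I.m = 0 <;> simp [h]

theorem exists_decides (n : ℕ) [NeZero n] (F : Notion) : ∃ (P : Prog) (p : Polynomial ℕ),
    ∀ (I : Instance n) (w : Fin n → ℚ), (∀ i, 0 < w i) → DecidesWithin P (encode F I w)
      (∃ A : Fin n → Finset (Fin I.m), I.IsSIM A ∧ I.IsFair w F A)
      (p.eval (inputSize (encode F I w) + I.maxValue)) := by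
  obtain ⟨K, hK⟩ := exists_runs_main n F
  refine ⟨Program.main n F, .C K * (numberPoly n + 1) ^ 3, fun I w hw => ?_⟩
  obtain ⟨t, τ, hx, ht, hτ⟩ := hK I w _ (env_init_encode F I w)
  refine ⟨t, τ, hx, ht.trans ?_, ?_⟩
  · simp only [Polynomial.eval_add, Polynomial.eval_mul, Polynomial.eval_pow,
      Polynomial.eval_one, Polynomial.eval_C]
    gcongr
    exact numberBound_le F I w
  · have hans : τ.reg 0 = τ.env.ans := rfl
    rw [hans, hτ, iterate_searchEnv_ans F I w hw]
    split_ifs with h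
    · exact Or.inl ⟨h, rfl⟩
    · exact Or.inr ⟨h, rfl⟩

end FairDivision

theorem mainTheorem4 (n : ℕ) (F : FairDivision.Notion) :
    ∃ (P : RAM.Prog) (p : Polynomial ℕ),
      ∀ (I : FairDivision.Instance n) (w : Fin n → ℚ), (∀ i, 0 < w i) →
        RAM.DecidesWithin P (FairDivision.encode F I w)
          (∃ A : Fin n → Finset (Fin I.m), I.IsSIM A ∧ I.IsFair w F A)
          (p.eval (RAM.inputSize (FairDivision.encode F I w) + I.maxValue)) := by
  rcases Nat.eq_zero_or_pos n with rfl | hn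
  · obtain ⟨P, p, h⟩ := FairDivision.exists_decides_no_agents F
    exact ⟨P, p, fun I w _ => h I w⟩
  · have : NeZero n := ⟨hn.ne'⟩
    exact FairDivision.exists_decides n F
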